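/- Fix $\theta\in\mathbb R$. Let $\mathcal O(S^7)=\mathbb C[z_a,z_a^*\mid a=1,\dots,4]/(\sum_a z_a^*z_a-1)$ and let $\mathcal O(SU(2))=\mathbb C[w_j,w_j^*\mid j=1,2]/(\sum_j w_j^*w_j-1)$ coact on it by the algebra map $\delta$ with $$\delta(\mathsf u)=\mathsf u\overset{.}{\otimes}\mathsf w,\qquad \mathsf u=\begin{pmatrix} z_1&z_2&z_3&z_4\\ -z_2^*&z_1^*&-z_4^*&z_3^*\end{pmatrix}^{t},\qquad \mathsf w=\begin{pmatrix} w_1&-w_2^*\\ w_2&w_1^*\end{pmatrix}.$$ With $\partial_a=\partial/\partial z_a$, $\partial_a^*=\partial/\partial z_a^*$, consider the following derivations of $\mathcal O(S^7)$: $$\begin{aligned} H_1&=\tfrac12(z_1\partial_1-z_1^*\partial_1^*-z_2\partial_2+z_2^*\partial_2^*-z_3\partial_3+z_3^*\partial_3^*+z_4\partial_4-z_4^*\partial_4^*),\\ H_2&=\tfrac12(-z_1\partial_1+z_1^*\partial_1^*+z_2\partial_2-z_2^*\partial_2^*-z_3\partial_3+z_3^*\partial_3^*+z_4\partial_4-z_4^*\partial_4^*),\\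 E_{10}&=\tfrac1{\sqrt2}(z_1\partial_3-z_3^*\partial_1^*-z_4\partial_2+z_2^*\partial_4^*),\quad E_{-10}=\tfrac1{\sqrt2}(z_3\partial_1-z_1^*\partial_3^*-z_2\partial_4+z_4^*\partial_2^*),\\ E_{01}&=\tfrac1{\sqrt2}(z_2\partial_3-z_3^*\partial_2^*+z_4\partial_1-z_1^*\partial_4^*),\quad E_{0-1}=\tfrac1{\sqrt2}(z_1\partial_4-z_4^*\partial_1^*+z_3\partial_2-z_2^*\partial_3^*),\\ E_{11}&=-z_4\partial_3+z_3^*\partial_4^*,\quad E_{-1-1}=z_4^*\partial_3^*-z_3\partial_4,\quad E_{1-1}=-z_1\partial_2+z_2^*\partial_1^*,\quad E_{-11}=-z_2\partial_1+z_1^*\partial_2^*, \end{aligned}$$ indexed by the roots $\mathsf r=(r_1,r_2)\in\Gamma=\{(\pm1,0),(0,\pm1),(\pm1,\pm1)\}$. They span a copy of the Lie algebra $so(5)$. Write $\mathsf r\wedge\mathsf s=r_1s_2-r_2s_1$. Let $K$ be the universal enveloping algebra of the abelian Lie algebra spanned by $H_1,H_2$, acting on linear maps by the adjoint action. Let $\mathsf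 F=e^{\pi i\theta(H_1\otimes H_2-H_2\otimes H_1)}$ and $\mathsf R_{\mathsf F}=\overline{\mathsf F}^{\,2}$, where $\overline{\mathsf F}=\mathsf F^{-1}$; these are evaluated on simultaneous eigenvectors of $H_1,H_2$, so $\overline{\mathsf F}$ acts as $e^{-\pi i\theta\,\mathsf s\wedge\mathsf t}$ on vectors of weight $\mathsf s\otimes\mathsf t$. Write $\overline{\mathsf F}=\overline{\mathsf F}^\alpha\otimes\overline{\mathsf F}_\alpha$ and $\mathsf R_{\mathsf F}=\mathsf R^\alpha\otimes\mathsf R_\alpha$. Let $\mathcal O(S^7_\theta)$ be the vector space $\mathcal O(S^7)$ with the product $a\bullet_\theta b=(\overline{\mathsf F}^\alpha\triangleright a)(\overline{\mathsf F}_\alpha\triangleright b)$ and the coaction $\delta$ (the same linear map), and let $\mathcal O(S^4_\theta)=\{b\in\mathcal O(S^7_\theta)\mid\delta(b)=b\otimes1\}$. Let $\mathrm{Der}_{\mathcal M^H}(\mathcal O(S^7_\theta))$ be the space of linear maps $\psi$ of $\mathcal O(S^7_\theta)$ to itself with $$\psi(a\bullet_\theta b)=\psi(a)\bullet_\theta b+(\mathsf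 R_\alpha\triangleright a)\bullet_\theta(\mathsf R^\alpha\triangleright\psi)(b),\qquad \delta\circ\psi=(\psi\otimes\mathrm{id})\circ\delta ,$$ with the bracket $[\psi,\lambda]_{\mathsf R_{\mathsf F}}=\psi\circ\lambda-(\mathsf R_\alpha\triangleright\lambda)\circ(\mathsf R^\alpha\triangleright\psi)$ and the left $\mathcal O(S^4_\theta)$-module structure $(b\,\psi)(a)=b\bullet_\theta\psi(a)$. For a linear map $\psi$ of $\mathcal O(S^7)$ put $\mathcal D(\psi)(a)=(\overline{\mathsf F}^\alpha\triangleright\psi)(\overline{\mathsf F}_\alpha\triangleright a)$, and let $\widetilde H_j=\mathcal D(H_j)$ for $j=1,2$, $\widetilde E_{\mathsf r}=\mathcal D(E_{\mathsf r})$ for $\mathsf r\in\Gamma$. Then $\mathrm{Der}_{\mathcal M^H}(\mathcal O(S^7_\theta))$ is a braided Lie algebra associated with $(K_{\mathsf F},\mathsf R_{\mathsf F})$ (a $K$-module, closed under the bracket, which is $K$-equivariant, braided antisymmetric and satisfies the braided Jacobi identity), and it is generated as a left $\mathcal O(S^4_\theta)$-module by the $\widetilde H_j$ and $\widetilde E_{\mathsf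 r}$. These ten elements are linearly independent over $\mathbb C$, and their complex span is a braided Lie algebra, $so_\theta(5)$, with brackets $$\begin{aligned} &[\widetilde H_j,\widetilde H_k]_{\mathsf R_{\mathsf F}}=\mathcal D([H_j,H_k])=0,\qquad [\widetilde H_j,\widetilde E_{\mathsf r}]_{\mathsf R_{\mathsf F}}=\mathcal D([H_j,E_{\mathsf r}])=r_j\widetilde E_{\mathsf r},\\ &[\widetilde E_{\mathsf r},\widetilde E_{-\mathsf r}]_{\mathsf R_{\mathsf F}}=\mathcal D([E_{\mathsf r},E_{-\mathsf r}])=r_1\widetilde H_1+r_2\widetilde H_2,\\ &[\widetilde E_{\mathsf r},\widetilde E_{\mathsf s}]_{\mathsf R_{\mathsf F}}=e^{-i\pi\theta\,\mathsf r\wedge\mathsf s}\,\mathcal D([E_{\mathsf r},E_{\mathsf s}])=e^{-i\pi\theta\,\mathsf r\wedge\mathsf s}N_{\mathsf r\mathsf s}\widetilde E_{\mathsf r+\mathsf s}\qquad(\mathsf r+\mathsf s\neq0), \end{aligned}$$ where the $N_{\mathsf r\mathsf s}$ are the structure constants of $so(5)$, $[E_{\mathsf r},E_{\mathsf s}]=N_{\mathsf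 r\mathsf s}E_{\mathsf r+\mathsf s}$ for $\mathsf r+\mathsf s\ne0$, with $N_{\mathsf r\mathsf s}=0$ if $\mathsf r+\mathsf s$ is not a root and $N_{\mathsf r\mathsf s}\in\{1,-1\}$ otherwise. -/

import Mathlib

open scoped TensorProduct
open DirectSum

noncomputable section

/-! ### The torus twist

The Hopf algebra `K` is the universal enveloping algebra of the abelian Lie algebra spanned by
`H₁, H₂`.  A `K`-module on which `H₁, H₂` are simultaneously diagonalisable with rational
eigenvalues is a vector space graded by its weights in `ℚ × ℚ`; the twist
`F = exp (π i θ (H₁ ⊗ H₂ - H₂ ⊗ H₁))` and `R_F = F⁻²` are evaluated on weight vectors. -/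

/-- Weights: pairs of eigenvalues of `(H₁, H₂)`. -/
abbrev Wt : Type := ℚ × ℚ

/-- `s ∧ t = s₁ t₂ - s₂ t₁`. -/
def wedge {R : Type*} [Ring R] (s t : R × R) : R := s.1 * t.2 - s.2 * t.1

/-- The eigenvalue of `F⁻¹ = exp (-π i θ (H₁ ⊗ H₂ - H₂ ⊗ H₁))` on (weight `s`) `⊗` (weight `t`). -/
def twistInv (θ : ℝ) (s t : Wt) : ℂ :=
  Complex.exp (-(Complex.I * Real.pi * θ * ((wedge s t : ℚ) : ℂ)))

/-- The eigenvalue of the universal `R`-matrix `R_F = F⁻²` on (weight `s`) `⊗` (weight `t`). -/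
def rMat (θ : ℝ) (s t : Wt) : ℂ := twistInv θ s t ^ 2

section Graded

variable {V : Type*} [AddCommGroup V] [Module ℂ V] (𝒱 : Wt → Submodule ℂ V)
  [DirectSum.Decomposition 𝒱]

/-- The linear map on `V` that is `φ s` on vectors of weight `s`. -/
def onWeights {N : Type*} [AddCommGroup N] [Module ℂ N] (φ : Wt → V →ₗ[ℂ] N) : V →ₗ[ℂ] N :=
  (DirectSum.toModule ℂ Wt N fun s => φ s ∘ₗ (𝒱 s).subtype) ∘ₗ
    (DirectSum.decomposeLinearEquiv 𝒱).toLinearMap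

theorem onWeights_apply {N : Type*} [AddCommGroup N] [Module ℂ N] (φ : Wt → V →ₗ[ℂ] N)
    {s : Wt} {a : V} (ha : a ∈ 𝒱 s) : onWeights 𝒱 φ a = φ s a := by
  lift a to 𝒱 s using ha
  rw [onWeights, LinearMap.comp_apply, LinearEquiv.coe_coe,
    DirectSum.decomposeLinearEquiv_apply_coe, DirectSum.toModule_lof]
  rfl

/-- The diagonal operator with eigenvalue `χ s` on weight `s`. -/
def diagOp (χ : Wt → ℂ) : V →ₗ[ℂ] V := onWeights 𝒱 fun s => χ s • LinearMap.id

theorem diagOp_apply (χ : Wt → ℂ) {s : Wt} {a : V} (ha : a ∈ 𝒱 s) :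
    diagOp 𝒱 χ a = χ s • a := by
  simp [diagOp, onWeights_apply 𝒱 _ ha]

/-- The adjoint action `k ▷ ψ = k₍₁₎ ∘ ψ ∘ S(k₍₂₎)` on linear maps, for the group-like element `k`
acting on weight `s` by the (multiplicative) scalar `χ s`. -/
def adOp (χ : Wt → ℂ) (ψ : Module.End ℂ V) : Module.End ℂ V :=
  diagOp 𝒱 χ ∘ₗ ψ ∘ₗ diagOp 𝒱 (fun s => (χ s)⁻¹)

/-- Linear maps of weight `r` for the adjoint action: those that raise weights by `r`. -/
def opWeight (r : Wt) : Submodule ℂ (Module.End ℂ V) where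
  carrier := {ψ | ∀ s, ∀ a ∈ 𝒱 s, ψ a ∈ 𝒱 (s + r)}
  add_mem' h h' s a ha := (𝒱 _).add_mem (h s a ha) (h' s a ha)
  zero_mem' _ _ _ := (𝒱 _).zero_mem
  smul_mem' c _ h s a ha := (𝒱 _).smul_mem c (h s a ha)

/-- The braided composition `ψ ⊗ lam ↦ (R_α ▷ lam) ∘ (R^α ▷ ψ)` for `R = R_F`.  On `a` of weight `m`,
the part of weight `n` of `ψ a` is the value at `a` of the component of `ψ` of weight `n - m`. -/
def braidedComp (θ : ℝ) (ψ lam : Module.End ℂ V) : Module.End ℂ V :=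
  onWeights 𝒱 fun m => (onWeights 𝒱 fun n => adOp 𝒱 (fun t => rMat θ (n - m) t) lam) ∘ₗ ψ

/-- The braided commutator `[ψ, lam] = ψ ∘ lam - (R_α ▷ lam) ∘ (R^α ▷ ψ)` for `R = R_F`. -/
def braidedBracket (θ : ℝ) (ψ lam : Module.End ℂ V) : Module.End ℂ V :=
  ψ ∘ₗ lam - braidedComp 𝒱 θ ψ lam

/-- `L` is a braided Lie algebra associated with `(K_F, R_F)` under the braided commutator:
a `K`-submodule (spanned by weight vectors) closed under the bracket, with `K`-equivariance,
braided antisymmetry and braided Jacobi identity, written on weight vectors `u, v`, for which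
`R_α ▷ v ⊗ R^α ▷ u = rMat θ r s • (v ⊗ u)`. -/
structure IsBraidedLieAlgebra (θ : ℝ) (L : Submodule ℂ (Module.End ℂ V)) : Prop where
  graded : L ≤ ⨆ r, L ⊓ opWeight 𝒱 r
  closed : ∀ u ∈ L, ∀ v ∈ L, braidedBracket 𝒱 θ u v ∈ L
  equivariant : ∀ r s, ∀ u ∈ L ⊓ opWeight 𝒱 r, ∀ v ∈ L ⊓ opWeight 𝒱 s,
    braidedBracket 𝒱 θ u v ∈ opWeight 𝒱 (r + s)
  antisymm : ∀ r s, ∀ u ∈ L ⊓ opWeight 𝒱 r, ∀ v ∈ L ⊓ opWeight 𝒱 s,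
    braidedBracket 𝒱 θ u v = -(rMat θ r s • braidedBracket 𝒱 θ v u)
  jacobi : ∀ r s, ∀ u ∈ L ⊓ opWeight 𝒱 r, ∀ v ∈ L ⊓ opWeight 𝒱 s, ∀ w ∈ L,
    braidedBracket 𝒱 θ u (braidedBracket 𝒱 θ v w) =
      braidedBracket 𝒱 θ (braidedBracket 𝒱 θ u v) w +
        rMat θ r s • braidedBracket 𝒱 θ v (braidedBracket 𝒱 θ u w)

end Graded

theorem wedge_add_left {R : Type*} [CommRing R] (s t u : R × R) :
    wedge (s + t) u = wedge s u + wedge t u := by simp [wedge]; ring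

theorem wedge_add_right {R : Type*} [CommRing R] (s t u : R × R) :
    wedge s (t + u) = wedge s t + wedge s u := by simp [wedge]; ring

theorem twistInv_add_left (θ : ℝ) (s t u : Wt) :
    twistInv θ (s + t) u = twistInv θ s u * twistInv θ t u := by
  rw [twistInv, twistInv, twistInv, ← Complex.exp_add, wedge_add_left]; push_cast; ring_nf

theorem twistInv_add_right (θ : ℝ) (s t u : Wt) :
    twistInv θ s (t + u) = twistInv θ s t * twistInv θ s u := by
  rw [twistInv, twistInv, twistInv, ← Complex.exp_add, wedge_add_right]; push_cast; ring_nf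

@[simp] theorem twistInv_zero_left (θ : ℝ) (s : Wt) : twistInv θ 0 s = 1 := by
  simp [twistInv, wedge]

@[simp] theorem twistInv_zero_right (θ : ℝ) (s : Wt) : twistInv θ s 0 = 1 := by
  simp [twistInv, wedge]

section TwistAlgebra

variable {A : Type*} [CommRing A] [Algebra ℂ A] (𝒜 : Wt → Submodule ℂ A)

/-- The vector space `A`, to be equipped with the twisted product. -/
def TwistAlg (_ : Wt → Submodule ℂ A) (_ : ℝ) : Type _ := A

variable (θ : ℝ)

instance : AddCommGroup (TwistAlg 𝒜 θ) := inferInstanceAs (AddCommGroup A)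
instance : Module ℂ (TwistAlg 𝒜 θ) := inferInstanceAs (Module ℂ A)

/-- The identity map `A → A_F`. -/
def toTwist : A ≃ₗ[ℂ] TwistAlg 𝒜 θ := LinearEquiv.refl ℂ A

/-- The weight spaces of `A_F` are those of `A`. -/
def twistWt : Wt → Submodule ℂ (TwistAlg 𝒜 θ) := 𝒜

variable [GradedAlgebra 𝒜]

instance : DirectSum.Decomposition (twistWt 𝒜 θ) :=
  inferInstanceAs (DirectSum.Decomposition 𝒜)

/-- The twisted product `a • b = (F⁻¹^α ▷ a) (F⁻¹_α ▷ b)` as a bilinear map. -/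
def twistMul : A →ₗ[ℂ] A →ₗ[ℂ] A :=
  onWeights 𝒜 fun s => (LinearMap.mul ℂ A).compl₂ (diagOp 𝒜 fun t => twistInv θ s t)

theorem twistMul_apply {s t : Wt} {a b : A} (ha : a ∈ 𝒜 s) (hb : b ∈ 𝒜 t) :
    twistMul 𝒜 θ a b = twistInv θ s t • (a * b) := by
  simp [twistMul, onWeights_apply 𝒜 _ ha, diagOp_apply 𝒜 _ hb]

theorem twistMul_assoc (a b c : A) :
    twistMul 𝒜 θ (twistMul 𝒜 θ a b) c = twistMul 𝒜 θ a (twistMul 𝒜 θ b c) := by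
  induction a using DirectSum.Decomposition.inductionOn 𝒜 with
  | zero => simp
  | add a a' h h' => simp [h, h']
  | @homogeneous s a =>
  induction b using DirectSum.Decomposition.inductionOn 𝒜 with
  | zero => simp
  | add a a' h h' => simp [h, h']
  | @homogeneous t b =>
  induction c using DirectSum.Decomposition.inductionOn 𝒜 with
  | zero => simp
  | add a a' h h' => simp [h, h']
  | @homogeneous u c =>
  have hab : (a * b : A) ∈ 𝒜 (s + t) := SetLike.mul_mem_graded a.2 b.2
  have hbc : (b * c : A) ∈ 𝒜 (t + u) := SetLike.mul_mem_graded b.2 c.2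
  rw [twistMul_apply 𝒜 θ a.2 b.2, twistMul_apply 𝒜 θ b.2 c.2, map_smul, LinearMap.smul_apply,
    map_smul, twistMul_apply 𝒜 θ hab c.2, twistMul_apply 𝒜 θ a.2 hbc, twistInv_add_left,
    twistInv_add_right, smul_smul, smul_smul, mul_assoc]
  congr 1; ring

theorem twistMul_one_left (a : A) : twistMul 𝒜 θ 1 a = a := by
  induction a using DirectSum.Decomposition.inductionOn 𝒜 with
  | zero => simp
  | add a a' h h' => simp [h, h']
  | @homogeneous s a =>
  rw [twistMul_apply 𝒜 θ (SetLike.one_mem_graded 𝒜) a.2]; simp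

theorem twistMul_one_right (a : A) : twistMul 𝒜 θ a 1 = a := by
  induction a using DirectSum.Decomposition.inductionOn 𝒜 with
  | zero => simp
  | add a a' h h' => simp [h, h']
  | @homogeneous s a =>
  rw [twistMul_apply 𝒜 θ a.2 (SetLike.one_mem_graded 𝒜)]; simp

instance : Ring (TwistAlg 𝒜 θ) where
  __ := (inferInstance : AddCommGroup (TwistAlg 𝒜 θ))
  mul a b := toTwist 𝒜 θ (twistMul 𝒜 θ ((toTwist 𝒜 θ).symm a) ((toTwist 𝒜 θ).symm b))
  one := toTwist 𝒜 θ 1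
  left_distrib _ _ _ := map_add (twistMul 𝒜 θ _) _ _
  right_distrib _ _ _ := LinearMap.map_add₂ (twistMul 𝒜 θ) _ _ _
  zero_mul _ := LinearMap.map_zero₂ (twistMul 𝒜 θ) _
  mul_zero _ := map_zero (twistMul 𝒜 θ _)
  mul_assoc _ _ _ := twistMul_assoc 𝒜 θ _ _ _
  one_mul _ := twistMul_one_left 𝒜 θ _
  mul_one _ := twistMul_one_right 𝒜 θ _

instance : Algebra ℂ (TwistAlg 𝒜 θ) :=
  Algebra.ofModule (fun c _ _ => LinearMap.map_smul₂ (twistMul 𝒜 θ) c _ _)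
    (fun c a b => map_smul (twistMul 𝒜 θ a) c b)

theorem toTwist_mul {s t : Wt} {a b : A} (ha : a ∈ 𝒜 s) (hb : b ∈ 𝒜 t) :
    toTwist 𝒜 θ a * toTwist 𝒜 θ b = twistInv θ s t • toTwist 𝒜 θ (a * b) :=
  twistMul_apply 𝒜 θ ha hb

/-- Braided derivations of `A_F`: linear maps with
`ψ (a • b) = ψ a • b + (R_α ▷ a) • (R^α ▷ ψ) b` for `R = R_F`. -/
def BraidedDer : Submodule ℂ (Module.End ℂ (TwistAlg 𝒜 θ)) where
  carrier := {ψ | ∀ s, ∀ a ∈ twistWt 𝒜 θ s, ∀ b,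
    ψ (a * b) = ψ a * b + a * adOp (twistWt 𝒜 θ) (fun t => rMat θ t s) ψ b}
  add_mem' h h' s a ha b := by
    simp only [LinearMap.add_apply, h s a ha b, h' s a ha b, adOp, LinearMap.coe_comp,
      Function.comp_apply, map_add, mul_add, add_mul]
    abel
  zero_mem' := by simp [adOp]
  smul_mem' c ψ h s a ha b := by
    simp only [LinearMap.smul_apply, h s a ha b, adOp, LinearMap.coe_comp,
      Function.comp_apply, map_smul, smul_add, smul_mul_assoc, mul_smul_comm]

/-- The map `D`, with `D(ψ)(a) = (F⁻¹^α ▷ ψ)(F⁻¹_α ▷ a)`. -/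
def twistD (ψ : Module.End ℂ A) : Module.End ℂ (TwistAlg 𝒜 θ) :=
  (toTwist 𝒜 θ).toLinearMap ∘ₗ
    (onWeights 𝒜 fun s => adOp 𝒜 (fun t => twistInv θ t s) ψ) ∘ₗ
    (toTwist 𝒜 θ).symm.toLinearMap

end TwistAlgebra

/-! ### The sphere `S⁷` and its `SU(2)`-coaction -/

/-- The free commutative algebra on `z_a = X (inl a)`, `z_a^* = X (inr a)`. -/
abbrev PolyZ : Type := MvPolynomial (Fin 4 ⊕ Fin 4) ℂ

/-- The polynomial variable `z_{a+1}`. -/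
abbrev pz (a : Fin 4) : PolyZ := MvPolynomial.X (Sum.inl a)

/-- The polynomial variable `z_{a+1}^*`. -/
abbrev pzs (a : Fin 4) : PolyZ := MvPolynomial.X (Sum.inr a)

/-- The partial derivative `∂_{a+1}`. -/
abbrev pd (a : Fin 4) : Derivation ℂ PolyZ PolyZ := MvPolynomial.pderiv (Sum.inl a)

/-- The partial derivative `∂_{a+1}^*`. -/
abbrev pds (a : Fin 4) : Derivation ℂ PolyZ PolyZ := MvPolynomial.pderiv (Sum.inr a)

/-- The sphere relation. -/
def sphereRel : PolyZ := ∑ a : Fin 4, pzs a * pz a - 1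

/-- `O(S⁷)`. -/
def S7 : Type := PolyZ ⧸ Ideal.span {sphereRel}

instance : CommRing S7 := inferInstanceAs (CommRing (PolyZ ⧸ Ideal.span {sphereRel}))
instance : Algebra ℂ S7 := inferInstanceAs (Algebra ℂ (PolyZ ⧸ Ideal.span {sphereRel}))

/-- The quotient map. -/
def S7.mk : PolyZ →ₐ[ℂ] S7 := Ideal.Quotient.mkₐ ℂ (Ideal.span {sphereRel})

theorem S7.mk_surjective : Function.Surjective S7.mk := Ideal.Quotient.mk_surjective

theorem S7.mk_eq_zero {p : PolyZ} : S7.mk p = 0 ↔ p ∈ Ideal.span {sphereRel} :=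
  Ideal.Quotient.eq_zero_iff_mem

/-- The coordinate function `z_{a+1}`. -/
def zCoord (a : Fin 4) : S7 := S7.mk (pz a)

/-- The coordinate function `z_{a+1}^*`. -/
def zsCoord (a : Fin 4) : S7 := S7.mk (pzs a)

theorem mk_derivation_eq_zero (d : Derivation ℂ PolyZ PolyZ) (hd : d sphereRel = 0) (p : PolyZ)
    (hp : S7.mk p = 0) : S7.mk (d p) = 0 := by
  rw [S7.mk_eq_zero, Ideal.mem_span_singleton'] at hp ⊢
  obtain ⟨c, rfl⟩ := hp
  exact ⟨d c, by simp [hd, mul_comm]⟩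

/-- The derivation of `O(S⁷)` induced by a derivation that annihilates the sphere relation. -/
def descend (d : Derivation ℂ PolyZ PolyZ) (hd : d sphereRel = 0) : Derivation ℂ S7 S7 :=
  Derivation.liftOfSurjective S7.mk_surjective (mk_derivation_eq_zero d hd)

theorem descend_mk (d : Derivation ℂ PolyZ PolyZ) (hd : d sphereRel = 0) (p : PolyZ) :
    descend d hd (S7.mk p) = S7.mk (d p) :=
  Derivation.liftOfSurjective_apply S7.mk_surjective (mk_derivation_eq_zero d hd) p

/-- `H_{j+1}` on polynomials. -/
def polyH : Fin 2 → Derivation ℂ PolyZ PolyZ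
  | 0 => (1 / 2 : ℂ) • (pz 0 • pd 0 - pzs 0 • pds 0 - pz 1 • pd 1 + pzs 1 • pds 1
      - pz 2 • pd 2 + pzs 2 • pds 2 + pz 3 • pd 3 - pzs 3 • pds 3)
  | 1 => (1 / 2 : ℂ) • (-(pz 0 • pd 0) + pzs 0 • pds 0 + pz 1 • pd 1 - pzs 1 • pds 1
      - pz 2 • pd 2 + pzs 2 • pds 2 + pz 3 • pd 3 - pzs 3 • pds 3)

/-- `1/√2`. -/
def invSqrt2 : ℂ := ((1 / Real.sqrt 2 : ℝ) : ℂ)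

/-- `E_r` on polynomials, for a root `r` (and `0` if `r` is not a root). -/
def polyE : ℤ × ℤ → Derivation ℂ PolyZ PolyZ
  | (1, 0) => invSqrt2 • (pz 0 • pd 2 - pzs 2 • pds 0 - pz 3 • pd 1 + pzs 1 • pds 3)
  | (-1, 0) => invSqrt2 • (pz 2 • pd 0 - pzs 0 • pds 2 - pz 1 • pd 3 + pzs 3 • pds 1)
  | (0, 1) => invSqrt2 • (pz 1 • pd 2 - pzs 2 • pds 1 + pz 3 • pd 0 - pzs 0 • pds 3)
  | (0, -1) => invSqrt2 • (pz 0 • pd 3 - pzs 3 • pds 0 + pz 2 • pd 1 - pzs 1 • pds 2)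
  | (1, 1) => -(pz 3 • pd 2) + pzs 2 • pds 3
  | (-1, -1) => pzs 3 • pds 2 - pz 2 • pd 3
  | (1, -1) => -(pz 0 • pd 1) + pzs 1 • pds 0
  | (-1, 1) => -(pz 1 • pd 0) + pzs 0 • pds 1
  | _ => 0

theorem polyH_sphereRel (j : Fin 2) : polyH j sphereRel = 0 := by
  fin_cases j <;>
    simp [polyH, sphereRel, Fin.sum_univ_four, MvPolynomial.pderiv_X] <;> ring_nf

theorem polyE_sphereRel (r : ℤ × ℤ) : polyE r sphereRel = 0 := by
  unfold polyE
  split <;>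
    simp [sphereRel, Fin.sum_univ_four, MvPolynomial.pderiv_X] <;> ring_nf <;> simp

/-- The derivations `H_{j+1}` of `O(S⁷)`. -/
def vecH (j : Fin 2) : Derivation ℂ S7 S7 := descend (polyH j) (polyH_sphereRel j)

/-- The derivations `E_r` of `O(S⁷)`. -/
def vecE (r : ℤ × ℤ) : Derivation ℂ S7 S7 := descend (polyE r) (polyE_sphereRel r)

/-- The set `Γ` of the eight roots. -/
def rootSet : Finset (ℤ × ℤ) :=
  {(1, 0), (-1, 0), (0, 1), (0, -1), (1, 1), (-1, -1), (1, -1), (-1, 1)}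

/-- The weight spaces of `O(S⁷)`: simultaneous eigenspaces of `H₁` and `H₂`. -/
def wtS7 (s : Wt) : Submodule ℂ S7 where
  carrier := {a | vecH 0 a = (s.1 : ℂ) • a ∧ vecH 1 a = (s.2 : ℂ) • a}
  add_mem' h h' := by simp_all
  zero_mem' := by simp
  smul_mem' c a h := by
    constructor
    · rw [Derivation.map_smul, h.1, smul_comm]
    · rw [Derivation.map_smul, h.2, smul_comm]

theorem mem_wtS7 {s : Wt} {a : S7} :
    a ∈ wtS7 s ↔ vecH 0 a = (s.1 : ℂ) • a ∧ vecH 1 a = (s.2 : ℂ) • a := Iff.rfl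

/-- The weights of the `z_a`. -/
def wtZ : Fin 4 → Wt := ![(1 / 2, -1 / 2), (-1 / 2, 1 / 2), (-1 / 2, -1 / 2), (1 / 2, 1 / 2)]

theorem z_mem (a : Fin 4) : zCoord a ∈ wtS7 (wtZ a) := by
  rw [mem_wtS7, zCoord, vecH, vecH, descend_mk, descend_mk, ← map_smul, ← map_smul]
  fin_cases a <;>
    simp [polyH, wtZ, MvPolynomial.pderiv_X, neg_div]

theorem zs_mem (a : Fin 4) : zsCoord a ∈ wtS7 (-wtZ a) := by
  rw [mem_wtS7, zsCoord, vecH, vecH, descend_mk, descend_mk, ← map_smul, ← map_smul]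
  fin_cases a <;>
    simp [polyH, wtZ, MvPolynomial.pderiv_X, neg_div]

theorem gen_mem (i : Fin 4 ⊕ Fin 4) : ∃ w, S7.mk (MvPolynomial.X i) ∈ wtS7 w := by
  rcases i with a | a
  · exact ⟨_, z_mem a⟩
  · exact ⟨_, zs_mem a⟩

instance : SetLike.GradedMonoid wtS7 where
  one_mem := by simp [mem_wtS7]
  mul_mem s t a b ha hb := by
    rw [mem_wtS7] at *
    constructor
    · rw [Derivation.leibniz, ha.1, hb.1]
      simp only [Prod.fst_add, Rat.cast_add, add_smul, smul_eq_mul, mul_smul_comm]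
      rw [mul_comm b a, add_comm]
    · rw [Derivation.leibniz, ha.2, hb.2]
      simp only [Prod.snd_add, Rat.cast_add, add_smul, smul_eq_mul, mul_smul_comm]
      rw [mul_comm b a, add_comm]

theorem iSup_wtS7 : ⨆ s, wtS7 s = ⊤ := by
  rw [eq_top_iff]
  rintro a -
  obtain ⟨p, rfl⟩ := S7.mk_surjective a
  induction p using MvPolynomial.induction_on with
  | C c =>
    refine Submodule.mem_iSup_of_mem 0 ?_
    have : S7.mk (MvPolynomial.C c) = algebraMap ℂ S7 c := S7.mk.commutes c
    rw [this, mem_wtS7]; simp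
  | add p q hp hq => rw [map_add]; exact Submodule.add_mem _ hp hq
  | mul_X p i hp =>
    rw [map_mul]
    obtain ⟨w, hw⟩ := gen_mem i
    generalize S7.mk p = y at hp ⊢
    induction hp using Submodule.iSup_induction' with
    | mem s x hx => exact Submodule.mem_iSup_of_mem (s + w) (SetLike.mul_mem_graded hx hw)
    | zero => simp
    | add x y _ _ hx hy => rw [add_mul]; exact Submodule.add_mem _ hx hy

theorem iSupIndep_wtS7 : iSupIndep wtS7 := by
  let L : Module.End ℂ S7 := (vecH 0).toLinearMap + ((Real.sqrt 2 : ℝ) : ℂ) • (vecH 1).toLinearMap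
  let f : Wt → ℂ := fun s => ((s.1 + Real.sqrt 2 * s.2 : ℝ) : ℂ)
  have hf : Function.Injective f := by
    intro s t h
    have h' : (s.1 + Real.sqrt 2 * s.2 : ℝ) = t.1 + Real.sqrt 2 * t.2 := Complex.ofReal_injective h
    have h2 : s.2 = t.2 := by
      by_contra hne
      have hne' : ((s.2 : ℝ) - t.2) ≠ 0 := by
        rw [sub_ne_zero]; exact_mod_cast hne
      apply irrational_sqrt_two
      refine ⟨(t.1 - s.1) / (s.2 - t.2), ?_⟩
      push_cast
      rw [div_eq_iff hne']
      linarith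
    refine Prod.ext ?_ h2
    rw [h2] at h'
    exact_mod_cast add_right_cancel h'
  refine (L.eigenspaces_iSupIndep.comp hf).mono fun s a ha => ?_
  rw [mem_wtS7] at ha
  simp only [Function.comp_apply, Module.End.mem_eigenspace_iff]
  simp [L, f, ha.1, ha.2, add_smul, mul_smul]

instance : GradedAlgebra wtS7 where
  toDecomposition := ((DirectSum.isInternal_submodule_iff_iSupIndep_and_iSup_eq_top wtS7).2
    ⟨iSupIndep_wtS7, iSup_wtS7⟩).chooseDecomposition

/-- The free commutative algebra on `w_j = X (inl j)`, `w_j^* = X (inr j)`. -/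
abbrev PolyW : Type := MvPolynomial (Fin 2 ⊕ Fin 2) ℂ

/-- The relation of `SU(2)`. -/
def su2Rel : PolyW :=
  ∑ j : Fin 2, MvPolynomial.X (Sum.inr j) * MvPolynomial.X (Sum.inl j) - 1

/-- `O(SU(2))`. -/
def SU2 : Type := PolyW ⧸ Ideal.span {su2Rel}

instance : CommRing SU2 := inferInstanceAs (CommRing (PolyW ⧸ Ideal.span {su2Rel}))
instance : Algebra ℂ SU2 := inferInstanceAs (Algebra ℂ (PolyW ⧸ Ideal.span {su2Rel}))

/-- The quotient map. -/
def SU2.mk : PolyW →ₐ[ℂ] SU2 := Ideal.Quotient.mkₐ ℂ (Ideal.span {su2Rel})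

/-- The coordinate function `w_{j+1}`. -/
def wCoord (j : Fin 2) : SU2 := SU2.mk (MvPolynomial.X (Sum.inl j))

/-- The coordinate function `w_{j+1}^*`. -/
def wsCoord (j : Fin 2) : SU2 := SU2.mk (MvPolynomial.X (Sum.inr j))

theorem su2_rel : wsCoord 0 * wCoord 0 + wsCoord 1 * wCoord 1 = 1 := by
  have h : SU2.mk su2Rel = 0 :=
    Ideal.Quotient.eq_zero_iff_mem.2 (Ideal.mem_span_singleton_self _)
  rw [su2Rel, map_sub, map_one, sub_eq_zero, Fin.sum_univ_two, map_add, map_mul, map_mul] at h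
  exact h

theorem s7_rel : zsCoord 0 * zCoord 0 + zsCoord 1 * zCoord 1 + zsCoord 2 * zCoord 2 + zsCoord 3 * zCoord 3 = 1 := by
  have h : S7.mk sphereRel = 0 := S7.mk_eq_zero.2 (Ideal.mem_span_singleton_self _)
  rw [sphereRel, map_sub, map_one, sub_eq_zero, Fin.sum_univ_four, map_add, map_add, map_add,
    map_mul, map_mul, map_mul, map_mul] at h
  exact h

/-- The matrix `u` of coordinate functions on `S⁷`. -/
def matU : Matrix (Fin 4) (Fin 2) S7 :=
  !![zCoord 0, -zsCoord 1; zCoord 1, zsCoord 0; zCoord 2, -zsCoord 3; zCoord 3, zsCoord 2]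

/-- The matrix `w` of coordinate functions on `SU(2)`. -/
def matW : Matrix (Fin 2) (Fin 2) SU2 :=
  !![wCoord 0, -wsCoord 1; wCoord 1, wsCoord 0]

/-- The matrix `u ⊗̇ w`. -/
def matUW (a : Fin 4) (k : Fin 2) : S7 ⊗[ℂ] SU2 := ∑ j, matU a j ⊗ₜ[ℂ] matW j k

/-- Values of the coaction on the generators: those for which `δ(u) = u ⊗̇ w`. -/
def coactGen : Fin 4 ⊕ Fin 4 → S7 ⊗[ℂ] SU2 :=
  Sum.elim (fun a => matUW a 0) ![matUW 1 1, -matUW 0 1, matUW 3 1, -matUW 2 1]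

theorem aeval_coactGen_sphereRel : MvPolynomial.aeval coactGen sphereRel = 0 := by
  have h1 : ∀ (x : S7) (h : SU2), x ⊗ₜ[ℂ] h = (x ⊗ₜ[ℂ] (1 : SU2)) * ((1 : S7) ⊗ₜ[ℂ] h) := by
    intro x h; simp
  have hs : (zsCoord 0 ⊗ₜ[ℂ] (1 : SU2)) * (zCoord 0 ⊗ₜ 1) + (zsCoord 1 ⊗ₜ 1) * (zCoord 1 ⊗ₜ 1)
      + (zsCoord 2 ⊗ₜ 1) * (zCoord 2 ⊗ₜ 1) + (zsCoord 3 ⊗ₜ 1) * (zCoord 3 ⊗ₜ 1) = 1 := by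
    simp only [Algebra.TensorProduct.tmul_mul_tmul, mul_one, ← TensorProduct.add_tmul, s7_rel]
    rfl
  have hw : ((1 : S7) ⊗ₜ[ℂ] wsCoord 0) * (1 ⊗ₜ wCoord 0) + (1 ⊗ₜ wsCoord 1) * (1 ⊗ₜ wCoord 1)
      = 1 := by
    simp only [Algebra.TensorProduct.tmul_mul_tmul, mul_one, ← TensorProduct.tmul_add, su2_rel]
    rfl
  have e : MvPolynomial.aeval coactGen sphereRel =
      coactGen (Sum.inr 0) * coactGen (Sum.inl 0) + coactGen (Sum.inr 1) * coactGen (Sum.inl 1)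
      + coactGen (Sum.inr 2) * coactGen (Sum.inl 2) + coactGen (Sum.inr 3) * coactGen (Sum.inl 3)
      - 1 := by
    rw [sphereRel, Fin.sum_univ_four]
    simp only [map_sub, map_one, map_add, map_mul, MvPolynomial.aeval_X]
  rw [e]
  simp only [coactGen, Sum.elim_inl, Sum.elim_inr, matUW, Fin.sum_univ_two, matU, matW,
    Matrix.cons_val, Matrix.of_apply, TensorProduct.neg_tmul, TensorProduct.tmul_neg]
  rw [h1 (zCoord 0) (wCoord 0), h1 (zCoord 1) (wCoord 0), h1 (zsCoord 0) (wsCoord 0),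
    h1 (zsCoord 1) (wsCoord 0), h1 (zsCoord 0) (wCoord 1), h1 (zsCoord 1) (wCoord 1),
    h1 (zCoord 0) (wsCoord 1), h1 (zCoord 1) (wsCoord 1), h1 (zCoord 2) (wCoord 0),
    h1 (zCoord 3) (wCoord 0), h1 (zsCoord 2) (wsCoord 0), h1 (zsCoord 3) (wsCoord 0),
    h1 (zsCoord 2) (wCoord 1), h1 (zsCoord 3) (wCoord 1), h1 (zCoord 2) (wsCoord 1),
    h1 (zCoord 3) (wsCoord 1)]
  linear_combination (((1 : S7) ⊗ₜ[ℂ] wsCoord 0) * (1 ⊗ₜ wCoord 0)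
    + (1 ⊗ₜ wsCoord 1) * (1 ⊗ₜ wCoord 1)) * hs + hw

/-- The right coaction `δ : O(S⁷) → O(S⁷) ⊗ O(SU(2))`. -/
def coact : S7 →ₐ[ℂ] S7 ⊗[ℂ] SU2 :=
  Ideal.Quotient.liftₐ (Ideal.span {sphereRel}) (MvPolynomial.aeval coactGen) (by
    intro p hp
    obtain ⟨c, rfl⟩ := Ideal.mem_span_singleton'.1 hp
    rw [map_mul, aeval_coactGen_sphereRel, mul_zero])

theorem coact_mk (p : PolyZ) : coact (S7.mk p) = MvPolynomial.aeval coactGen p := rfl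

theorem coact_matU (a : Fin 4) (k : Fin 2) : coact (matU a k) = matUW a k := by
  fin_cases a <;> fin_cases k <;>
    simp [matU, zCoord, zsCoord, coact_mk, coactGen]

/-! ### The twisted bundle -/

/-- `O(S⁷_θ)`. -/
abbrev S7t (θ : ℝ) : Type := TwistAlg wtS7 θ

/-- The weight spaces of `O(S⁷_θ)`. -/
abbrev wtS7t (θ : ℝ) : Wt → Submodule ℂ (S7t θ) := twistWt wtS7 θ

/-- Elements of weight `s` in `O(S⁷) ⊗ O(SU(2))`. -/
def wtTensor (s : Wt) : Submodule ℂ (S7 ⊗[ℂ] SU2) :=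
  Submodule.span ℂ {X | ∃ x ∈ wtS7 s, ∃ h, X = x ⊗ₜ[ℂ] h}

theorem tmul_mem_wtTensor {s : Wt} {x : S7} (hx : x ∈ wtS7 s) (h : SU2) :
    x ⊗ₜ[ℂ] h ∈ wtTensor s := Submodule.subset_span ⟨x, hx, h, rfl⟩

theorem mul_mem_wtTensor {s t : Wt} {X Y : S7 ⊗[ℂ] SU2} (hX : X ∈ wtTensor s)
    (hY : Y ∈ wtTensor t) : X * Y ∈ wtTensor (s + t) := by
  induction hX using Submodule.span_induction with
  | zero => simp
  | add X X' _ _ h h' => rw [add_mul]; exact add_mem h h'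
  | smul c X _ h => rw [smul_mul_assoc]; exact Submodule.smul_mem _ _ h
  | mem X hX =>
  obtain ⟨x, hx, h, rfl⟩ := hX
  induction hY using Submodule.span_induction with
  | zero => simp
  | add X X' _ _ h h' => rw [mul_add]; exact add_mem h h'
  | smul c X _ h => rw [mul_smul_comm]; exact Submodule.smul_mem _ _ h
  | mem Y hY =>
  obtain ⟨y, hy, k, rfl⟩ := hY
  rw [Algebra.TensorProduct.tmul_mul_tmul]
  exact tmul_mem_wtTensor (SetLike.mul_mem_graded hx hy) _

theorem coactGen_mem (i : Fin 4 ⊕ Fin 4) :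
    ∃ w, S7.mk (MvPolynomial.X i) ∈ wtS7 w ∧ coactGen i ∈ wtTensor w := by
  have hz := z_mem
  have hzs := zs_mem
  have e : -wtZ 1 = wtZ 0 := by simp [wtZ, neg_div]
  have e' : -wtZ 3 = wtZ 2 := by simp [wtZ, neg_div]
  have e1 : -wtZ 0 = wtZ 1 := by simp [wtZ, neg_div]
  have e1' : -wtZ 2 = wtZ 3 := by simp [wtZ, neg_div]
  have key : ∀ {s : Wt} {x y : S7} (h k : SU2), x ∈ wtS7 s → y ∈ wtS7 s →
      x ⊗ₜ[ℂ] h + y ⊗ₜ[ℂ] k ∈ wtTensor s := fun h k hx hy =>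
    add_mem (tmul_mem_wtTensor hx h) (tmul_mem_wtTensor hy k)
  have h0 : ∀ k, matUW 0 k ∈ wtTensor (wtZ 0) := fun k => by
    rw [matUW, Fin.sum_univ_two]
    exact key _ _ (hz 0) (neg_mem (e ▸ hzs 1))
  have h1 : ∀ k, matUW 1 k ∈ wtTensor (wtZ 1) := fun k => by
    rw [matUW, Fin.sum_univ_two]
    exact key _ _ (hz 1) (e1 ▸ hzs 0)
  have h2 : ∀ k, matUW 2 k ∈ wtTensor (wtZ 2) := fun k => by
    rw [matUW, Fin.sum_univ_two]
    exact key _ _ (hz 2) (neg_mem (e' ▸ hzs 3))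
  have h3 : ∀ k, matUW 3 k ∈ wtTensor (wtZ 3) := fun k => by
    rw [matUW, Fin.sum_univ_two]
    exact key _ _ (hz 3) (e1' ▸ hzs 2)
  rcases i with a | a
  · refine ⟨_, hz a, ?_⟩
    fin_cases a
    exacts [h0 0, h1 0, h2 0, h3 0]
  · refine ⟨_, hzs a, ?_⟩
    fin_cases a
    · exact e1.symm ▸ h1 1
    · exact e.symm ▸ neg_mem (h0 1)
    · exact e1'.symm ▸ h3 1
    · exact e'.symm ▸ neg_mem (h2 1)

theorem coact_mem {s : Wt} {a : S7} (ha : a ∈ wtS7 s) : coact a ∈ wtTensor s := by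
  have key : ∀ (p : PolyZ), S7.mk p ∈ ⨆ s, wtS7 s ⊓ (wtTensor s).comap coact.toLinearMap := by
    intro p
    induction p using MvPolynomial.induction_on with
    | C c =>
      have h : S7.mk (MvPolynomial.C c) = algebraMap ℂ S7 c := S7.mk.commutes c
      refine Submodule.mem_iSup_of_mem 0 ⟨?_, ?_⟩
      · rw [h, SetLike.mem_coe, mem_wtS7]; simp
      · rw [h, Algebra.algebraMap_eq_smul_one]
        refine Submodule.smul_mem _ _ ?_
        change coact 1 ∈ wtTensor 0
        rw [map_one]
        exact tmul_mem_wtTensor (SetLike.one_mem_graded wtS7) 1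
    | add p q hp hq => rw [map_add]; exact Submodule.add_mem _ hp hq
    | mul_X p i hp =>
      rw [map_mul]
      obtain ⟨w, hw, hw'⟩ := coactGen_mem i
      generalize S7.mk p = y at hp ⊢
      induction hp using Submodule.iSup_induction' with
      | mem s x hx =>
        refine Submodule.mem_iSup_of_mem (s + w) ⟨SetLike.mul_mem_graded hx.1 hw, ?_⟩
        change coact (x * S7.mk (MvPolynomial.X i)) ∈ wtTensor (s + w)
        rw [map_mul, coact_mk, MvPolynomial.aeval_X]
        exact mul_mem_wtTensor hx.2 hw'
      | zero => simp
      | add x y _ _ hx hy => rw [add_mul]; exact Submodule.add_mem _ hx hy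
  have key2 : ∀ (x : S7) (s : Wt),
      coact (DirectSum.decompose wtS7 x s : S7) ∈ wtTensor s := by
    intro x s
    obtain ⟨p, rfl⟩ := S7.mk_surjective x
    have hp := key p
    generalize S7.mk p = y at hp ⊢
    induction hp using Submodule.iSup_induction' with
    | mem t x hx =>
      by_cases hts : t = s
      · subst hts; rw [DirectSum.decompose_of_mem_same _ hx.1]; exact hx.2
      · rw [DirectSum.decompose_of_mem_ne _ hx.1 hts, map_zero]; exact zero_mem _
    | zero => simp
    | add x y _ _ hx hy =>
      rw [DirectSum.decompose_add, DirectSum.add_apply, Submodule.coe_add, map_add]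
      exact add_mem hx hy
  have := key2 a s
  rwa [DirectSum.decompose_of_mem_same _ ha] at this

/-- The identity map `O(S⁷) ⊗ O(SU(2)) → O(S⁷_θ) ⊗ O(SU(2))`. -/
def toTwistTensor (θ : ℝ) : S7 ⊗[ℂ] SU2 →ₗ[ℂ] S7t θ ⊗[ℂ] SU2 :=
  (toTwist wtS7 θ).toLinearMap.rTensor SU2

theorem toTwistTensor_mul (θ : ℝ) {s t : Wt} {X Y : S7 ⊗[ℂ] SU2} (hX : X ∈ wtTensor s)
    (hY : Y ∈ wtTensor t) :
    toTwistTensor θ X * toTwistTensor θ Y = twistInv θ s t • toTwistTensor θ (X * Y) := by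
  induction hX using Submodule.span_induction with
  | zero => simp
  | add X X' _ _ h h' => rw [map_add, add_mul, add_mul, map_add, smul_add, h, h']
  | smul c X _ h => rw [map_smul, smul_mul_assoc, smul_mul_assoc, map_smul, h, smul_comm]
  | mem X hX =>
  obtain ⟨x, hx, h, rfl⟩ := hX
  induction hY using Submodule.span_induction with
  | zero => simp
  | add X X' _ _ h h' => rw [map_add, mul_add, mul_add, map_add, smul_add, h, h']
  | smul c X _ h => rw [map_smul, mul_smul_comm, mul_smul_comm, map_smul, h, smul_comm]
  | mem Y hY =>
  obtain ⟨y, hy, k, rfl⟩ := hY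
  rw [Algebra.TensorProduct.tmul_mul_tmul]
  simp only [toTwistTensor, LinearMap.rTensor_tmul, LinearEquiv.coe_coe,
    Algebra.TensorProduct.tmul_mul_tmul]
  rw [toTwist_mul wtS7 θ hx hy, TensorProduct.smul_tmul']

theorem toTwistTensor_coact_mul (θ : ℝ) (a b : S7) :
    toTwistTensor θ (coact (twistMul wtS7 θ a b)) =
      toTwistTensor θ (coact a) * toTwistTensor θ (coact b) := by
  induction a using DirectSum.Decomposition.inductionOn wtS7 with
  | zero => simp
  | add a a' h h' => simp [h, h', add_mul]
  | @homogeneous s a =>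
  induction b using DirectSum.Decomposition.inductionOn wtS7 with
  | zero => simp
  | add a a' h h' => simp [h, h', mul_add]
  | @homogeneous t b =>
  rw [twistMul_apply wtS7 θ a.2 b.2, map_smul, map_smul, map_mul,
    toTwistTensor_mul θ (coact_mem a.2) (coact_mem b.2)]

/-- The coaction `δ : O(S⁷_θ) → O(S⁷_θ) ⊗ O(SU(2))`: the same linear map as for `θ = 0`. -/
def coactT (θ : ℝ) : S7t θ →ₐ[ℂ] S7t θ ⊗[ℂ] SU2 :=
  AlgHom.ofLinearMap
    (toTwistTensor θ ∘ₗ coact.toLinearMap ∘ₗ (toTwist wtS7 θ).symm.toLinearMap)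
    (by
      change toTwistTensor θ (coact 1) = _
      rw [map_one]; rfl)
    (fun a b => toTwistTensor_coact_mul θ _ _)

/-- `O(S⁴_θ)`: the subalgebra of coinvariants `{b | δ b = b ⊗ 1}`. -/
def S4t (θ : ℝ) : Subalgebra ℂ (S7t θ) :=
  AlgHom.equalizer (coactT θ) Algebra.TensorProduct.includeLeft

theorem mem_S4t (θ : ℝ) (b : S7t θ) : b ∈ S4t θ ↔ coactT θ b = b ⊗ₜ[ℂ] 1 := Iff.rfl

/-- The `O(SU(2))`-equivariant braided derivations of `O(S⁷_θ)`: braided derivations `ψ` with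
`δ ∘ ψ = (ψ ⊗ id) ∘ δ`. -/
def DerH (θ : ℝ) : Submodule ℂ (Module.End ℂ (S7t θ)) :=
  BraidedDer wtS7 θ ⊓
    { carrier := {ψ | ∀ a, coactT θ (ψ a) = ψ.rTensor SU2 (coactT θ a)}
      add_mem' := fun h h' a => by
        simp only [LinearMap.add_apply, map_add, LinearMap.rTensor_add, h a, h' a]
      zero_mem' := by simp
      smul_mem' := fun c ψ h a => by
        simp only [LinearMap.smul_apply, map_smul, LinearMap.rTensor_smul, h a] }

/-- `H̃_{j+1} = D(H_{j+1})`. -/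
def tildeH (θ : ℝ) (j : Fin 2) : Module.End ℂ (S7t θ) := twistD wtS7 θ (vecH j).toLinearMap

/-- `Ẽ_r = D(E_r)`. -/
def tildeE (θ : ℝ) (r : ℤ × ℤ) : Module.End ℂ (S7t θ) := twistD wtS7 θ (vecE r).toLinearMap

/-- The ten elements `H̃_j`, `Ẽ_r` with `r` a root. -/
def gens (θ : ℝ) : Fin 2 ⊕ rootSet → Module.End ℂ (S7t θ) :=
  Sum.elim (tildeH θ) fun r => tildeE θ r

end

/-! The theorem is the classical case transported along the twist. On an input of weight `s`, the
map `twistD` only rescales the output, by `twistInv θ t s` in each weight `t` (`twistD_apply`). It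
is therefore a weight-preserving linear bijection from operators on the untwisted algebra to
operators on the twisted one. Everything in the statement has a counterpart on the untwisted side.
Derivations correspond to braided derivations (`twistD_mem_braidedDer`,
`exists_derivation_of_mem_braidedDer`). Equivariance is unchanged, because the coaction preserves
weights (`coactT_twistD_iff`). On operators of weights `r` and `s` the braided commutator is
`twistInv θ r s` times the twist of the ordinary commutator (`braidedBracket_twistD`). Left
multiplication by a coinvariant is altered only by an invertible diagonal operator on the
coefficient (`twistD_mul_left`, `smul_gens`). The braided Lie axioms hold for any graded space of
operators closed under the braided commutator (`IsBraidedLieAlgebra.of_graded`).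

What remains is classical, and there so(5) appears as sp(4). The coaction multiplies the rows of the
4 by 2 matrix `u` by `w`, which has determinant one, so 2 by 2 minors of such rows are coinvariant.
The sphere relation says that the minors of rows 0, 1 and of rows 2, 3 add up to 1, a symplectic
condition. By Cramer's rule it lets every row be expanded in the rows of `u` with minors as
coefficients. Applied to an equivariant derivation this gives a matrix of coinvariants, which can be
corrected to a symmetric one (`derMat_spec`, `derMat_symm`). Its ten independent entries are, up to
normalisation and a change of basis on the diagonal torus, the coefficients along the `H_j` and
`E_r` (`exists_coeff_of_isEquivariant`).

The ten derivations act on `u` by constant matrices (`ActsBy`), and a derivation is determined by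
its values on `u`. All brackets thus become commutators of integer 4 by 4 matrices, which are
checked by computation. Evaluation at coordinate points of the sphere gives linear independence. -/

noncomputable section

/-! ### Diagonal operators and operators of definite weight -/

section GradedOperators

variable {V : Type*} [AddCommGroup V] [Module ℂ V] (𝒱 : Wt → Submodule ℂ V)
  [DirectSum.Decomposition 𝒱]

/-- Linear maps that agree on weight vectors are equal. -/
theorem linearMap_ext_of_weights {N : Type*} [AddCommGroup N] [Module ℂ N] {f g : V →ₗ[ℂ] N}
    (h : ∀ s, ∀ a ∈ 𝒱 s, f a = g a) : f = g := by
  ext a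
  induction a using DirectSum.Decomposition.inductionOn 𝒱 with
  | zero => simp
  | add a b ha hb => rw [map_add, map_add, ha, hb]
  | @homogeneous s a => exact h s a a.2

theorem onWeights_add {N : Type*} [AddCommGroup N] [Module ℂ N] (φ φ' : Wt → V →ₗ[ℂ] N) :
    onWeights 𝒱 (φ + φ') = onWeights 𝒱 φ + onWeights 𝒱 φ' :=
  linearMap_ext_of_weights 𝒱 fun s a ha => by
    simp [onWeights_apply 𝒱 _ ha]

theorem onWeights_smul {N : Type*} [AddCommGroup N] [Module ℂ N] (c : ℂ) (φ : Wt → V →ₗ[ℂ] N) :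
    onWeights 𝒱 (c • φ) = c • onWeights 𝒱 φ :=
  linearMap_ext_of_weights 𝒱 fun s a ha => by
    simp [onWeights_apply 𝒱 _ ha]

theorem diagOp_diagOp (χ χ' : Wt → ℂ) (a : V) :
    diagOp 𝒱 χ (diagOp 𝒱 χ' a) = diagOp 𝒱 (χ * χ') a := by
  induction a using DirectSum.Decomposition.inductionOn 𝒱 with
  | zero => simp
  | add a b ha hb => simp only [map_add, ha, hb]
  | @homogeneous s a =>
    rw [diagOp_apply 𝒱 _ a.2, map_smul, diagOp_apply 𝒱 _ a.2, diagOp_apply 𝒱 _ a.2, smul_smul,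
      Pi.mul_apply, mul_comm]

theorem diagOp_one (a : V) : diagOp 𝒱 1 a = a := by
  induction a using DirectSum.Decomposition.inductionOn 𝒱 with
  | zero => simp
  | add a b ha hb => simp only [map_add, ha, hb]
  | @homogeneous s a => rw [diagOp_apply 𝒱 _ a.2, Pi.one_apply, one_smul]

theorem diagOp_inv_cancel {χ : Wt → ℂ} (hχ : ∀ t, χ t ≠ 0) (a : V) :
    diagOp 𝒱 χ (diagOp 𝒱 (fun t => (χ t)⁻¹) a) = a := by
  rw [diagOp_diagOp]
  rw [show (χ * fun t => (χ t)⁻¹) = 1 from funext fun t => mul_inv_cancel₀ (hχ t), diagOp_one]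

theorem diagOp_inv_cancel' {χ : Wt → ℂ} (hχ : ∀ t, χ t ≠ 0) (a : V) :
    diagOp 𝒱 (fun t => (χ t)⁻¹) (diagOp 𝒱 χ a) = a := by
  simpa using diagOp_inv_cancel 𝒱 (χ := fun t => (χ t)⁻¹) (fun t => inv_ne_zero (hχ t)) a

theorem adOp_apply (χ : Wt → ℂ) (ψ : Module.End ℂ V) {s : Wt} {a : V} (ha : a ∈ 𝒱 s) :
    adOp 𝒱 χ ψ a = (χ s)⁻¹ • diagOp 𝒱 χ (ψ a) := by
  simp [adOp, diagOp_apply 𝒱 _ ha]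

theorem adOp_add (χ : Wt → ℂ) (ψ ψ' : Module.End ℂ V) :
    adOp 𝒱 χ (ψ + ψ') = adOp 𝒱 χ ψ + adOp 𝒱 χ ψ' := by
  ext; simp [adOp]

theorem adOp_smul (χ : Wt → ℂ) (c : ℂ) (ψ : Module.End ℂ V) :
    adOp 𝒱 χ (c • ψ) = c • adOp 𝒱 χ ψ := by
  ext; simp [adOp]

/-- A group-like element acts on linear maps of weight `r` by its value at `r`. -/
theorem adOp_of_mem_opWeight {χ : Wt → ℂ} (hχ : ∀ s t, χ (s + t) = χ s * χ t)
    (h0 : ∀ s, χ s ≠ 0) {r : Wt} {ψ : Module.End ℂ V} (hψ : ψ ∈ opWeight 𝒱 r) :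
    adOp 𝒱 χ ψ = χ r • ψ :=
  linearMap_ext_of_weights 𝒱 fun s a ha => by
    rw [adOp_apply 𝒱 χ ψ ha, diagOp_apply 𝒱 χ (hψ s a ha), smul_smul, hχ,
      inv_mul_cancel_left₀ (h0 s), LinearMap.smul_apply]

theorem comp_mem_opWeight {r s : Wt} {ψ lam : Module.End ℂ V} (hψ : ψ ∈ opWeight 𝒱 r)
    (hlam : lam ∈ opWeight 𝒱 s) : ψ ∘ₗ lam ∈ opWeight 𝒱 (r + s) := fun t a ha => by
  have := hψ _ _ (hlam t a ha)
  rwa [show t + s + r = t + (r + s) by abel] at this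

/-! ### Bicharacter identities for the twist and the R-matrix -/

theorem twistInv_ne_zero (θ : ℝ) (s t : Wt) : twistInv θ s t ≠ 0 := Complex.exp_ne_zero _

@[simp] theorem twistInv_self (θ : ℝ) (s : Wt) : twistInv θ s s = 1 := by
  simp [twistInv, wedge, mul_comm]

theorem twistInv_mul_swap (θ : ℝ) (s t : Wt) : twistInv θ s t * twistInv θ t s = 1 := by
  rw [twistInv, twistInv, ← Complex.exp_add, Complex.exp_eq_one_iff]
  refine ⟨0, ?_⟩
  simp [wedge]
  ring

theorem twistInv_swap (θ : ℝ) (s t : Wt) : twistInv θ t s = (twistInv θ s t)⁻¹ :=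
  eq_inv_of_mul_eq_one_right (twistInv_mul_swap θ s t)

theorem rMat_ne_zero (θ : ℝ) (s t : Wt) : rMat θ s t ≠ 0 := pow_ne_zero _ (twistInv_ne_zero θ s t)

theorem rMat_add_left (θ : ℝ) (s t u : Wt) : rMat θ (s + t) u = rMat θ s u * rMat θ t u := by
  rw [rMat, twistInv_add_left, mul_pow]; rfl

theorem rMat_add_right (θ : ℝ) (s t u : Wt) : rMat θ s (t + u) = rMat θ s t * rMat θ s u := by
  rw [rMat, twistInv_add_right, mul_pow]; rfl

theorem rMat_mul_swap (θ : ℝ) (s t : Wt) : rMat θ s t * rMat θ t s = 1 := by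
  rw [rMat, rMat, ← mul_pow, twistInv_mul_swap, one_pow]

/-! ### The braided commutator on weight vectors -/

theorem braidedComp_apply (θ : ℝ) (ψ lam : Module.End ℂ V) {m : Wt} {a : V} (ha : a ∈ 𝒱 m) :
    braidedComp 𝒱 θ ψ lam a =
      onWeights 𝒱 (fun n => adOp 𝒱 (fun t => rMat θ (n - m) t) lam) (ψ a) := by
  rw [braidedComp, onWeights_apply 𝒱 _ ha]; rfl

/-- For `ψ` of weight `r` the output weight minus the input weight is always `r`, so the R-matrix
sees only the pair `(r, s)` and acts as a scalar. -/
theorem braidedComp_of_mem_opWeight (θ : ℝ) {r s : Wt} {ψ lam : Module.End ℂ V}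
    (hψ : ψ ∈ opWeight 𝒱 r) (hlam : lam ∈ opWeight 𝒱 s) :
    braidedComp 𝒱 θ ψ lam = rMat θ r s • (lam ∘ₗ ψ) :=
  linearMap_ext_of_weights 𝒱 fun m a ha => by
    rw [braidedComp_apply 𝒱 θ ψ lam ha, onWeights_apply 𝒱 _ (hψ m a ha), add_sub_cancel_left,
      adOp_of_mem_opWeight 𝒱 (rMat_add_right θ r) (rMat_ne_zero θ r) hlam]
    rfl

theorem braidedBracket_of_mem_opWeight (θ : ℝ) {r s : Wt} {ψ lam : Module.End ℂ V}
    (hψ : ψ ∈ opWeight 𝒱 r) (hlam : lam ∈ opWeight 𝒱 s) :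
    braidedBracket 𝒱 θ ψ lam = ψ ∘ₗ lam - rMat θ r s • (lam ∘ₗ ψ) := by
  rw [braidedBracket, braidedComp_of_mem_opWeight 𝒱 θ hψ hlam]

/-- The braided commutator as a bilinear map. -/
def braidedBracketBilin (θ : ℝ) :
    Module.End ℂ V →ₗ[ℂ] Module.End ℂ V →ₗ[ℂ] Module.End ℂ V :=
  LinearMap.mk₂ ℂ (braidedBracket 𝒱 θ)
    (fun ψ ψ' lam => linearMap_ext_of_weights 𝒱 fun m a ha => by
      simp only [braidedBracket, LinearMap.sub_apply, LinearMap.add_apply,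
        braidedComp_apply 𝒱 θ _ _ ha, LinearMap.comp_apply, map_add]
      abel)
    (fun c ψ lam => linearMap_ext_of_weights 𝒱 fun m a ha => by
      simp only [braidedBracket, LinearMap.sub_apply, LinearMap.smul_apply,
        braidedComp_apply 𝒱 θ _ _ ha, LinearMap.comp_apply, map_smul, smul_sub])
    (fun ψ lam lam' => linearMap_ext_of_weights 𝒱 fun m a ha => by
      have h : (fun n => adOp 𝒱 (fun t => rMat θ (n - m) t) (lam + lam')) =
          (fun n => adOp 𝒱 (fun t => rMat θ (n - m) t) lam) +
            fun n => adOp 𝒱 (fun t => rMat θ (n - m) t) lam' := by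
        ext1 n; exact adOp_add 𝒱 _ _ _
      simp only [braidedBracket, LinearMap.sub_apply, LinearMap.add_apply,
        braidedComp_apply 𝒱 θ _ _ ha, LinearMap.comp_apply, map_add, h, onWeights_add]
      abel)
    (fun c ψ lam => linearMap_ext_of_weights 𝒱 fun m a ha => by
      have h : (fun n => adOp 𝒱 (fun t => rMat θ (n - m) t) (c • lam)) =
          c • fun n => adOp 𝒱 (fun t => rMat θ (n - m) t) lam := by
        ext1 n; exact adOp_smul 𝒱 _ _ _
      simp only [braidedBracket, LinearMap.sub_apply, LinearMap.smul_apply,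
        braidedComp_apply 𝒱 θ _ _ ha, LinearMap.comp_apply, map_smul, h, onWeights_smul,
        smul_sub])

theorem braidedBracketBilin_apply (θ : ℝ) (ψ lam : Module.End ℂ V) :
    braidedBracketBilin 𝒱 θ ψ lam = braidedBracket 𝒱 θ ψ lam := rfl

theorem braidedBracket_mem_opWeight (θ : ℝ) {r s : Wt} {ψ lam : Module.End ℂ V}
    (hψ : ψ ∈ opWeight 𝒱 r) (hlam : lam ∈ opWeight 𝒱 s) :
    braidedBracket 𝒱 θ ψ lam ∈ opWeight 𝒱 (r + s) := by
  rw [braidedBracket_of_mem_opWeight 𝒱 θ hψ hlam]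
  exact sub_mem (comp_mem_opWeight 𝒱 hψ hlam)
    (Submodule.smul_mem _ _ (add_comm s r ▸ comp_mem_opWeight 𝒱 hlam hψ))

/-- Expand all brackets into triple composites. Bimultiplicativity of `rMat` matches the
coefficients, and `rMat θ r s * rMat θ s r = 1` handles the terms where `u` and `v` have been
exchanged twice. -/
theorem braidedBracket_jacobi (θ : ℝ) {r s t : Wt} {u v w : Module.End ℂ V}
    (hu : u ∈ opWeight 𝒱 r) (hv : v ∈ opWeight 𝒱 s) (hw : w ∈ opWeight 𝒱 t) :
    braidedBracket 𝒱 θ u (braidedBracket 𝒱 θ v w) =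
      braidedBracket 𝒱 θ (braidedBracket 𝒱 θ u v) w +
        rMat θ r s • braidedBracket 𝒱 θ v (braidedBracket 𝒱 θ u w) := by
  rw [braidedBracket_of_mem_opWeight 𝒱 θ hu (braidedBracket_mem_opWeight 𝒱 θ hv hw),
    braidedBracket_of_mem_opWeight 𝒱 θ (braidedBracket_mem_opWeight 𝒱 θ hu hv) hw,
    braidedBracket_of_mem_opWeight 𝒱 θ hv (braidedBracket_mem_opWeight 𝒱 θ hu hw),
    braidedBracket_of_mem_opWeight 𝒱 θ hu hv, braidedBracket_of_mem_opWeight 𝒱 θ hu hw,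
    braidedBracket_of_mem_opWeight 𝒱 θ hv hw, rMat_add_left, rMat_add_right, rMat_add_right]
  have h := rMat_mul_swap θ r s
  ext a
  simp only [LinearMap.sub_apply, LinearMap.add_apply, LinearMap.smul_apply, LinearMap.comp_apply,
    map_sub, map_smul, smul_sub, smul_smul]
  rw [← mul_assoc, h, one_mul, mul_comm (rMat θ r s) (rMat θ r t)]
  module

/-- A graded space of linear maps whose weight vectors are closed under the braided commutator is
a braided Lie algebra. -/
theorem IsBraidedLieAlgebra.of_graded (θ : ℝ) {L : Submodule ℂ (Module.End ℂ V)}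
    (graded : L ≤ ⨆ r, L ⊓ opWeight 𝒱 r)
    (closed : ∀ r s, ∀ u ∈ L ⊓ opWeight 𝒱 r, ∀ v ∈ L ⊓ opWeight 𝒱 s,
      braidedBracket 𝒱 θ u v ∈ L) : IsBraidedLieAlgebra 𝒱 θ L where
  graded := graded
  closed u hu v hv := by
    replace hu := graded hu
    replace hv := graded hv
    induction hu using Submodule.iSup_induction' with
    | zero => rw [← braidedBracketBilin_apply, map_zero]; exact zero_mem L
    | add u u' _ _ h h' => rw [← braidedBracketBilin_apply, map_add]; exact add_mem h h'
    | mem r u hu =>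
      induction hv using Submodule.iSup_induction' with
      | zero => rw [← braidedBracketBilin_apply, map_zero]; exact zero_mem L
      | add v v' _ _ h h' => rw [← braidedBracketBilin_apply, map_add]; exact add_mem h h'
      | mem s v hv => exact closed r s u hu v hv
  equivariant r s u hu v hv := braidedBracket_mem_opWeight 𝒱 θ hu.2 hv.2
  antisymm r s u hu v hv := by
    rw [braidedBracket_of_mem_opWeight 𝒱 θ hu.2 hv.2, braidedBracket_of_mem_opWeight 𝒱 θ hv.2 hu.2,
      smul_sub, smul_smul, rMat_mul_swap, one_smul, neg_sub]
  jacobi r s u hu v hv w hw := by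
    replace hw := graded hw
    induction hw using Submodule.iSup_induction' with
    | zero => simp only [← braidedBracketBilin_apply, map_zero, smul_zero, add_zero]
    | add w w' _ _ h h' =>
      simp only [← braidedBracketBilin_apply, map_add, smul_add] at h h' ⊢
      rw [h, h']
      abel
    | mem t w hw => exact braidedBracket_jacobi 𝒱 θ hu.2 hv.2 hw.2

end GradedOperators

/-! ### The correspondence `twistD` between classical and braided operators -/

section TwistedDerivations

variable {A : Type*} [CommRing A] [Algebra ℂ A] (𝒜 : Wt → Submodule ℂ A) [GradedAlgebra 𝒜] (θ : ℝ)

theorem diagOp_mul {χ : Wt → ℂ} (hχ : ∀ s t, χ (s + t) = χ s * χ t) (a b : A) :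
    diagOp 𝒜 χ (a * b) = diagOp 𝒜 χ a * diagOp 𝒜 χ b := by
  induction a using DirectSum.Decomposition.inductionOn 𝒜 with
  | zero => simp
  | add a a' h h' => simp only [add_mul, map_add, h, h']
  | @homogeneous s a =>
  induction b using DirectSum.Decomposition.inductionOn 𝒜 with
  | zero => simp
  | add a a' h h' => simp only [mul_add, map_add, h, h']
  | @homogeneous t b =>
  rw [diagOp_apply 𝒜 χ (SetLike.mul_mem_graded a.2 b.2), diagOp_apply 𝒜 χ a.2,
    diagOp_apply 𝒜 χ b.2, smul_mul_smul_comm, hχ]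

/-- The adjoint action would also rescale the input, but by the inverse of `twistInv θ s s = 1`.
Only the output is affected. -/
theorem twistD_apply (ψ : Module.End ℂ A) {s : Wt} {a : A} (ha : a ∈ 𝒜 s) :
    twistD 𝒜 θ ψ (toTwist 𝒜 θ a) = toTwist 𝒜 θ (diagOp 𝒜 (fun t => twistInv θ t s) (ψ a)) := by
  rw [twistD, LinearMap.comp_apply, LinearMap.comp_apply, LinearEquiv.coe_coe, LinearEquiv.coe_coe,
    LinearEquiv.symm_apply_apply, onWeights_apply 𝒜 _ ha, adOp_apply 𝒜 _ _ ha]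
  simp

/-- Linear maps on the twisted algebra are determined by their values on weight vectors. -/
theorem twist_hom_ext {N : Type*} [AddCommGroup N] [Module ℂ N] {f g : TwistAlg 𝒜 θ →ₗ[ℂ] N}
    (h : ∀ s, ∀ a ∈ 𝒜 s, f (toTwist 𝒜 θ a) = g (toTwist 𝒜 θ a)) : f = g :=
  linearMap_ext_of_weights (twistWt 𝒜 θ) h

/-- `twistD` as a linear map. -/
def twistDLin : Module.End ℂ A →ₗ[ℂ] Module.End ℂ (TwistAlg 𝒜 θ) where
  toFun := twistD 𝒜 θ
  map_add' ψ ψ' := twist_hom_ext 𝒜 θ fun s a ha => by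
    simp [twistD_apply 𝒜 θ _ ha]
  map_smul' c ψ := twist_hom_ext 𝒜 θ fun s a ha => by
    simp [twistD_apply 𝒜 θ _ ha]

theorem twistDLin_apply (ψ : Module.End ℂ A) : twistDLin 𝒜 θ ψ = twistD 𝒜 θ ψ := rfl

theorem twistDLin_injective : Function.Injective (twistDLin 𝒜 θ) := by
  intro ψ ψ' h
  refine linearMap_ext_of_weights 𝒜 fun s a ha => ?_
  have h1 : twistD 𝒜 θ ψ (toTwist 𝒜 θ a) = twistD 𝒜 θ ψ' (toTwist 𝒜 θ a) :=
    LinearMap.congr_fun h _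
  rw [twistD_apply 𝒜 θ _ ha, twistD_apply 𝒜 θ _ ha] at h1
  have h2 := congrArg (diagOp 𝒜 fun t => (twistInv θ t s)⁻¹) ((toTwist 𝒜 θ).injective h1)
  rwa [diagOp_inv_cancel' 𝒜 (fun t => twistInv_ne_zero θ t s),
    diagOp_inv_cancel' 𝒜 (fun t => twistInv_ne_zero θ t s)] at h2

/-- The inverse of `twistD`. -/
def untwistD (ψ : Module.End ℂ (TwistAlg 𝒜 θ)) : Module.End ℂ A :=
  onWeights 𝒜 fun s => diagOp 𝒜 (fun t => (twistInv θ t s)⁻¹) ∘ₗ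
    (toTwist 𝒜 θ).symm.toLinearMap ∘ₗ ψ ∘ₗ (toTwist 𝒜 θ).toLinearMap

theorem untwistD_apply (ψ : Module.End ℂ (TwistAlg 𝒜 θ)) {s : Wt} {a : A} (ha : a ∈ 𝒜 s) :
    untwistD 𝒜 θ ψ a = diagOp 𝒜 (fun t => (twistInv θ t s)⁻¹)
      ((toTwist 𝒜 θ).symm (ψ (toTwist 𝒜 θ a))) := by
  rw [untwistD, onWeights_apply 𝒜 _ ha]; rfl

theorem twistD_untwistD (ψ : Module.End ℂ (TwistAlg 𝒜 θ)) : twistD 𝒜 θ (untwistD 𝒜 θ ψ) = ψ :=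
  twist_hom_ext 𝒜 θ fun s a ha => by
    rw [twistD_apply 𝒜 θ _ ha, untwistD_apply 𝒜 θ _ ha,
      diagOp_inv_cancel 𝒜 (fun t => twistInv_ne_zero θ t s), LinearEquiv.apply_symm_apply]

theorem twistD_mem_opWeight {r : Wt} {ψ : Module.End ℂ A} (hψ : ψ ∈ opWeight 𝒜 r) :
    twistD 𝒜 θ ψ ∈ opWeight (twistWt 𝒜 θ) r := fun s a ha => by
  have h := twistD_apply 𝒜 θ ψ (a := (toTwist 𝒜 θ).symm a) ha
  have hm : ψ ((toTwist 𝒜 θ).symm a) ∈ 𝒜 (s + r) := hψ s ((toTwist 𝒜 θ).symm a) ha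
  rw [diagOp_apply 𝒜 _ hm, LinearEquiv.apply_symm_apply] at h
  rw [h]
  exact Submodule.smul_mem _ _ hm

theorem mem_opWeight_of_twistD {r : Wt} {ψ : Module.End ℂ A}
    (hψ : twistD 𝒜 θ ψ ∈ opWeight (twistWt 𝒜 θ) r) : ψ ∈ opWeight 𝒜 r := fun s a ha => by
  have h : diagOp 𝒜 (fun t => twistInv θ t s) (ψ a) ∈ 𝒜 (s + r) := by
    have h1 := hψ s (toTwist 𝒜 θ a) ha
    rwa [twistD_apply 𝒜 θ ψ ha] at h1
  rw [← diagOp_inv_cancel' 𝒜 (fun t => twistInv_ne_zero θ t s) (ψ a), diagOp_apply 𝒜 _ h]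
  exact Submodule.smul_mem _ _ h

/-- On linear maps of weight `r`, the twist of `ψ` is `ψ` up to a scalar on each weight space. -/
theorem twistD_apply_of_mem_opWeight {r s : Wt} {ψ : Module.End ℂ A} (hψ : ψ ∈ opWeight 𝒜 r)
    {a : A} (ha : a ∈ 𝒜 s) :
    twistD 𝒜 θ ψ (toTwist 𝒜 θ a) = twistInv θ r s • toTwist 𝒜 θ (ψ a) := by
  rw [twistD_apply 𝒜 θ ψ ha, diagOp_apply 𝒜 _ (hψ s a ha), twistInv_add_left, twistInv_self,
    one_mul, map_smul]

/-- The braided commutator of twisted linear maps. -/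
theorem braidedBracket_twistD {r s : Wt} {ψ lam : Module.End ℂ A} (hψ : ψ ∈ opWeight 𝒜 r)
    (hlam : lam ∈ opWeight 𝒜 s) :
    braidedBracket (twistWt 𝒜 θ) θ (twistD 𝒜 θ ψ) (twistD 𝒜 θ lam) =
      twistInv θ r s • twistD 𝒜 θ ⁅ψ, lam⁆ := by
  rw [braidedBracket_of_mem_opWeight _ θ (twistD_mem_opWeight 𝒜 θ hψ)
    (twistD_mem_opWeight 𝒜 θ hlam), Ring.lie_def]
  have h1 := comp_mem_opWeight 𝒜 hψ hlam
  have h2 := comp_mem_opWeight 𝒜 hlam hψ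
  rw [add_comm] at h2
  refine twist_hom_ext 𝒜 θ fun t a ha => ?_
  change _ = (_ • twistD 𝒜 θ (ψ ∘ₗ lam - lam ∘ₗ ψ)) _
  rw [LinearMap.smul_apply, twistD_apply_of_mem_opWeight 𝒜 θ (sub_mem h1 h2) ha]
  simp only [LinearMap.sub_apply, LinearMap.smul_apply, LinearMap.comp_apply,
    twistD_apply_of_mem_opWeight 𝒜 θ hlam ha, twistD_apply_of_mem_opWeight 𝒜 θ hψ ha,
    map_smul, map_sub, twistD_apply_of_mem_opWeight 𝒜 θ hlam (hψ t a ha),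
    twistD_apply_of_mem_opWeight 𝒜 θ hψ (hlam t a ha), smul_smul, smul_sub, twistInv_add_right,
    twistInv_add_left, rMat]
  -- Composing in the opposite order produces `twistInv θ s r` in place of `twistInv θ r s`; the
  -- factor `rMat θ r s` is exactly what converts one into the other.
  have := twistInv_mul_swap θ r s
  congr 2
  · ring
  · linear_combination (twistInv θ r s * twistInv θ r t * twistInv θ s t) * this

theorem toTwist_mul_left {s : Wt} {a : A} (ha : a ∈ 𝒜 s) (b : A) :
    toTwist 𝒜 θ a * toTwist 𝒜 θ b = toTwist 𝒜 θ (a * diagOp 𝒜 (twistInv θ s) b) := by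
  change toTwist 𝒜 θ (twistMul 𝒜 θ a b) = _
  rw [twistMul, onWeights_apply 𝒜 _ ha]; rfl

theorem toTwist_mul_right {t : Wt} (a : A) {b : A} (hb : b ∈ 𝒜 t) :
    toTwist 𝒜 θ a * toTwist 𝒜 θ b =
      toTwist 𝒜 θ (diagOp 𝒜 (fun s => twistInv θ s t) a * b) := by
  induction a using DirectSum.Decomposition.inductionOn 𝒜 with
  | zero => simp
  | add a a' h h' => simp only [map_add, add_mul, h, h']
  | @homogeneous s a =>
    rw [toTwist_mul 𝒜 θ a.2 hb, diagOp_apply 𝒜 _ a.2, smul_mul_assoc, map_smul]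

theorem diagOp_twist (χ : Wt → ℂ) (a : A) :
    diagOp (twistWt 𝒜 θ) χ (toTwist 𝒜 θ a) = toTwist 𝒜 θ (diagOp 𝒜 χ a) := rfl

/-- The braided Leibniz rule for `twistD ψ` on weight vectors is a scalar multiple of the Leibniz
rule for `ψ`, up to an invertible diagonal operator. -/
theorem twistD_leibniz_aux (ψ : Module.End ℂ A) {s t : Wt} {a b : A} (ha : a ∈ 𝒜 s)
    (hb : b ∈ 𝒜 t) :
    twistD 𝒜 θ ψ (toTwist 𝒜 θ a * toTwist 𝒜 θ b) =
        toTwist 𝒜 θ (diagOp 𝒜 (fun u => twistInv θ u (s + t)) (twistInv θ s t • ψ (a * b))) ∧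
    twistD 𝒜 θ ψ (toTwist 𝒜 θ a) * toTwist 𝒜 θ b + toTwist 𝒜 θ a *
        adOp (twistWt 𝒜 θ) (fun t => rMat θ t s) (twistD 𝒜 θ ψ) (toTwist 𝒜 θ b) =
      toTwist 𝒜 θ (diagOp 𝒜 (fun u => twistInv θ u (s + t))
        (twistInv θ s t • (ψ a * b + a * ψ b))) := by
  have hmul : ∀ u v, twistInv θ (u + v) (s + t) = twistInv θ u (s + t) * twistInv θ v (s + t) :=
    fun u v => twistInv_add_left θ u v (s + t)
  -- In both Leibniz terms the twist of the product and the twist in `twistD` combine to the one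
  -- character `twistInv θ · (s + t)`. In the second term, the factor `twistInv θ s u` from
  -- multiplying by `a` on the left is turned into `twistInv θ u s` by the R-matrix.
  have e1 : (fun s => twistInv θ s t) * (fun t => twistInv θ t s) =
      fun u => twistInv θ u (s + t) := funext fun u => by
    simp [twistInv_add_right, mul_comm]
  have e2 : twistInv θ s * ((fun t => rMat θ t s) * fun u => twistInv θ u t) =
      fun u => twistInv θ u (s + t) := funext fun u => by
    have := twistInv_mul_swap θ s u
    simp only [Pi.mul_apply, rMat, twistInv_add_right]
    linear_combination twistInv θ u s * twistInv θ u t * this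
  constructor
  · rw [toTwist_mul 𝒜 θ ha hb, map_smul, twistD_apply 𝒜 θ ψ (SetLike.mul_mem_graded ha hb),
      map_smul, map_smul]
  · rw [adOp_apply _ _ _ (show toTwist 𝒜 θ b ∈ twistWt 𝒜 θ t from hb), twistD_apply 𝒜 θ ψ ha,
      twistD_apply 𝒜 θ ψ hb, toTwist_mul_right 𝒜 θ _ hb, diagOp_twist, mul_smul_comm,
      toTwist_mul_left 𝒜 θ ha, diagOp_diagOp, diagOp_diagOp, diagOp_diagOp, e1, mul_assoc, e2, ← map_smul,
      ← map_add]
    -- The common diagonal operator comes from a character, hence is multiplicative; only scalars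
    -- depending on `s` and `t` are left to compare.
    congr 1
    rw [map_smul, map_add, diagOp_mul 𝒜 hmul, diagOp_mul 𝒜 hmul, diagOp_apply 𝒜 _ hb,
      diagOp_apply 𝒜 _ ha, smul_add, mul_smul_comm, smul_mul_assoc, smul_smul, smul_smul,
      twistInv_add_right, twistInv_add_right, twistInv_self, twistInv_self, mul_one, one_mul,
      twistInv_mul_swap, one_smul]
    congr 2
    rw [rMat, twistInv_swap θ s t, inv_pow, inv_inv, sq]

/-- `twistD` carries derivations to braided derivations. -/
theorem twistD_mem_braidedDer (d : Derivation ℂ A A) :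
    twistD 𝒜 θ d.toLinearMap ∈ BraidedDer 𝒜 θ := by
  intro s a ha b
  induction b using DirectSum.Decomposition.inductionOn (twistWt 𝒜 θ) with
  | zero => simp
  | add b b' h h' => simp only [mul_add, map_add, h, h']; abel
  | @homogeneous t b =>
  have h := twistD_leibniz_aux 𝒜 θ d.toLinearMap (a := (toTwist 𝒜 θ).symm a)
    (b := (toTwist 𝒜 θ).symm b) ha b.2
  simp only [LinearEquiv.apply_symm_apply] at h
  rw [h.1, h.2]
  simp only [Derivation.coeFn_coe, Derivation.leibniz, smul_eq_mul]
  congr 3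
  ring

/-- Braided derivations are twists of derivations. -/
theorem exists_derivation_of_mem_braidedDer {ψ : Module.End ℂ (TwistAlg 𝒜 θ)}
    (hψ : ψ ∈ BraidedDer 𝒜 θ) : ∃ d : Derivation ℂ A A, twistD 𝒜 θ d.toLinearMap = ψ := by
  have key : ∀ a b : A, untwistD 𝒜 θ ψ (a * b) =
      a • untwistD 𝒜 θ ψ b + b • untwistD 𝒜 θ ψ a := by
    intro a b
    induction a using DirectSum.Decomposition.inductionOn 𝒜 with
    | zero => simp
    | add a a' h h' => simp only [add_mul, map_add, h, h', add_smul, smul_add]; abel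
    | @homogeneous s a =>
    induction b using DirectSum.Decomposition.inductionOn 𝒜 with
    | zero => simp
    | add b b' h h' => simp only [mul_add, map_add, h, h', add_smul, smul_add]; abel
    | @homogeneous t b =>
    have h := twistD_leibniz_aux 𝒜 θ (untwistD 𝒜 θ ψ) a.2 b.2
    rw [twistD_untwistD] at h
    have h1 := (h.1.symm.trans (hψ s (toTwist 𝒜 θ a) a.2 (toTwist 𝒜 θ b))).trans h.2
    -- The braided and classical Leibniz rules differ by this invertible diagonal operator and the
    -- nonzero scalar `twistInv θ s t`; both are now cancelled.
    have h2 := congrArg (diagOp 𝒜 fun u => (twistInv θ u (s + t))⁻¹) ((toTwist 𝒜 θ).injective h1)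
    rw [diagOp_inv_cancel' 𝒜 (fun u => twistInv_ne_zero θ u (s + t)),
      diagOp_inv_cancel' 𝒜 (fun u => twistInv_ne_zero θ u (s + t))] at h2
    rw [smul_right_injective A (twistInv_ne_zero θ s t) h2, add_comm, smul_eq_mul, smul_eq_mul,
      mul_comm (b : A)]
  exact ⟨Derivation.mk' (untwistD 𝒜 θ ψ) key, twistD_untwistD 𝒜 θ ψ⟩

/-- The left module structure of the twisted algebra in terms of the untwisted one. -/
theorem twistD_mul_left {r : Wt} {ψ : Module.End ℂ A} (hψ : ψ ∈ opWeight 𝒜 r) (b : A)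
    (x : TwistAlg 𝒜 θ) :
    twistD 𝒜 θ (LinearMap.mulLeft ℂ b ∘ₗ ψ) x =
      toTwist 𝒜 θ (diagOp 𝒜 (twistInv θ r) b) * twistD 𝒜 θ ψ x := by
  induction x using DirectSum.Decomposition.inductionOn (twistWt 𝒜 θ) with
  | zero => simp
  | add x x' h h' => simp only [mul_add, map_add, h, h']
  | @homogeneous s x =>
  obtain ⟨x, hx⟩ := x
  have hx' : (toTwist 𝒜 θ).symm x ∈ 𝒜 s := hx
  generalize hy : (toTwist 𝒜 θ).symm x = y at hx'
  obtain rfl : toTwist 𝒜 θ y = x := by rw [← hy, LinearEquiv.apply_symm_apply]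
  rw [twistD_apply_of_mem_opWeight 𝒜 θ hψ hx', twistD_apply 𝒜 θ _ hx', LinearMap.comp_apply,
    LinearMap.mulLeft_apply, diagOp_mul 𝒜 (fun u v => twistInv_add_left θ u v s),
    diagOp_apply 𝒜 _ (hψ s y hx'), mul_smul_comm, mul_smul_comm, map_smul,
    toTwist_mul_right 𝒜 θ _ (hψ s y hx'), twistInv_add_left, twistInv_self, one_mul,
    diagOp_diagOp]
  congr 6
  ext u
  -- On the part of `b` of weight `u`, the twisted product with an element of weight `s + r`
  -- contributes the extra factor `twistInv θ u r`, which `twistInv θ r u` cancels.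
  have h := twistInv_mul_swap θ u r
  simp only [Pi.mul_apply, twistInv_add_right]
  linear_combination -twistInv θ u s * h

end TwistedDerivations

/-! ### Equivariant derivations of the sphere -/

theorem matU_rel :
    matU 0 0 * matU 1 1 - matU 0 1 * matU 1 0 + (matU 2 0 * matU 3 1 - matU 2 1 * matU 3 0) = 1 := by
  simp only [matU, Matrix.of_apply, Matrix.cons_val]
  linear_combination s7_rel

/-- Induction on `O(S⁷)` from the entries of the matrix `u`. -/
theorem S7.induction_matU {P : S7 → Prop} (hC : ∀ c : ℂ, P (algebraMap ℂ S7 c))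
    (hU : ∀ a k, P (matU a k)) (hadd : ∀ x y, P x → P y → P (x + y))
    (hmul : ∀ x y, P x → P y → P (x * y)) (x : S7) : P x := by
  have hneg : ∀ x, P (-x) → P x := fun x hx => by
    have h := hmul _ _ (hC (-1)) hx
    simpa using h
  obtain ⟨p, rfl⟩ := S7.mk_surjective x
  induction p using MvPolynomial.induction_on with
  | C c => exact hC c
  | add p q hp hq => rw [map_add]; exact hadd _ _ hp hq
  | mul_X p i hp =>
    rw [map_mul]
    refine hmul _ _ hp ?_
    rcases i with a | a
    · have h := hU a 0
      fin_cases a <;> exact h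
    · fin_cases a
      · exact hU 1 1
      · exact hneg _ (hU 0 1)
      · exact hU 3 1
      · exact hneg _ (hU 2 1)

theorem derivation_ext_matU {d d' : Derivation ℂ S7 S7}
    (h : ∀ a k, d (matU a k) = d' (matU a k)) : d = d' := by
  ext x
  induction x using S7.induction_matU with
  | hC c => simp
  | hU a k => exact h a k
  | hadd x y hx hy => rw [map_add, map_add, hx, hy]
  | hmul x y hx hy => rw [Derivation.leibniz, Derivation.leibniz, hx, hy]

/-! ### Derivations acting by constant matrices -/

/-- The derivation `d` acts on the matrix `u` as the constant matrix `M`. -/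
def ActsBy (d : Derivation ℂ S7 S7) (M : Matrix (Fin 4) (Fin 4) ℂ) : Prop :=
  ∀ a k, d (matU a k) = ∑ b, M a b • matU b k

theorem ActsBy.smul {d : Derivation ℂ S7 S7} {M : Matrix (Fin 4) (Fin 4) ℂ} (h : ActsBy d M)
    (c : ℂ) : ActsBy (c • d) (c • M) := fun a k => by
  simp [h a k, Finset.smul_sum, smul_smul]

theorem ActsBy.add {d d' : Derivation ℂ S7 S7} {M M' : Matrix (Fin 4) (Fin 4) ℂ} (h : ActsBy d M)
    (h' : ActsBy d' M') : ActsBy (d + d') (M + M') := fun a k => by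
  simp [h a k, h' a k, add_smul, Finset.sum_add_distrib]

theorem sum_smul_sum_matU (M M' : Matrix (Fin 4) (Fin 4) ℂ) (a : Fin 4) (k : Fin 2) :
    ∑ b, M a b • ∑ c, M' b c • matU c k = ∑ c, (M * M') a c • matU c k := by
  simp only [Finset.smul_sum, smul_smul, Matrix.mul_apply, Finset.sum_smul]
  exact Finset.sum_comm

/-- The order of the matrices is reversed because constants pass through derivations: applying `d`
to `M' * u` gives `M' * M * u`. -/
theorem ActsBy.lie {d d' : Derivation ℂ S7 S7} {M M' : Matrix (Fin 4) (Fin 4) ℂ} (h : ActsBy d M)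
    (h' : ActsBy d' M') : ActsBy ⁅d, d'⁆ (M' * M - M * M') := fun a k => by
  rw [Derivation.commutator_apply, h' a k, h a k, map_sum, map_sum]
  simp only [Derivation.map_smul, h _ k, h' _ k]
  rw [sum_smul_sum_matU, sum_smul_sum_matU, ← Finset.sum_sub_distrib]
  exact Finset.sum_congr rfl fun b _ => by rw [Matrix.sub_apply, sub_smul]

theorem ActsBy.unique {d d' : Derivation ℂ S7 S7} {M : Matrix (Fin 4) (Fin 4) ℂ} (h : ActsBy d M)
    (h' : ActsBy d' M) : d = d' :=
  derivation_ext_matU fun a k => (h a k).trans (h' a k).symm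

theorem actsBy_zero : ActsBy 0 0 := fun a k => by simp

/-! ### The Lie algebra so(5) in integer matrices -/

/-- Twice the matrix by which `H_{j+1}` acts. -/
def hMat (j : Fin 2) : Matrix (Fin 4) (Fin 4) ℤ :=
  ![Matrix.diagonal ![1, -1, -1, 1], Matrix.diagonal ![-1, 1, -1, 1]] j

/-- The matrix by which `E_r` acts, up to normalisation. -/
def eMat (r : ℤ × ℤ) : Matrix (Fin 4) (Fin 4) ℤ :=
  if r = (1, 0) then !![0, 0, 0, 0; 0, 0, 0, -1; 1, 0, 0, 0; 0, 0, 0, 0]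
  else if r = (-1, 0) then !![0, 0, 1, 0; 0, 0, 0, 0; 0, 0, 0, 0; 0, -1, 0, 0]
  else if r = (0, 1) then !![0, 0, 0, 1; 0, 0, 0, 0; 0, 1, 0, 0; 0, 0, 0, 0]
  else if r = (0, -1) then !![0, 0, 0, 0; 0, 0, 1, 0; 0, 0, 0, 0; 1, 0, 0, 0]
  else if r = (1, 1) then !![0, 0, 0, 0; 0, 0, 0, 0; 0, 0, 0, -1; 0, 0, 0, 0]
  else if r = (-1, -1) then !![0, 0, 0, 0; 0, 0, 0, 0; 0, 0, 0, 0; 0, 0, -1, 0]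
  else if r = (1, -1) then !![0, 0, 0, 0; -1, 0, 0, 0; 0, 0, 0, 0; 0, 0, 0, 0]
  else if r = (-1, 1) then !![0, -1, 0, 0; 0, 0, 0, 0; 0, 0, 0, 0; 0, 0, 0, 0]
  else 0

/-- Short roots. -/
abbrev IsShort (r : ℤ × ℤ) : Prop := r.1 = 0 ∨ r.2 = 0

/-- The normalisation of `E_r`. -/
def eNorm (r : ℤ × ℤ) : ℂ := if IsShort r then invSqrt2 else 1

theorem invSqrt2_mul_self : invSqrt2 * invSqrt2 = 1 / 2 := by
  rw [invSqrt2, ← Complex.ofReal_mul, div_mul_div_comm, one_mul,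
    Real.mul_self_sqrt (by norm_num)]
  norm_num

theorem invSqrt2_ne_zero : invSqrt2 ≠ 0 := fun h => by
  have := invSqrt2_mul_self
  simp [h] at this

/-- Integer matrices as complex matrices. -/
abbrev castMat : Matrix (Fin 4) (Fin 4) ℤ →+* Matrix (Fin 4) (Fin 4) ℂ :=
  (Int.castRingHom ℂ).mapMatrix

theorem actsBy_vecH (j : Fin 2) :
    ActsBy (vecH j) ((1 / 2 : ℂ) • castMat (hMat j)) := by
  intro a k
  fin_cases j <;> fin_cases a <;> fin_cases k <;>
    simp [matU, zCoord, zsCoord, vecH, descend_mk, polyH, MvPolynomial.pderiv_X, hMat,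
      Matrix.diagonal_apply]

set_option maxHeartbeats 2000000 in
theorem actsBy_vecE {r : ℤ × ℤ} (hr : r ∈ rootSet) :
    ActsBy (vecE r) (eNorm r • castMat (eMat r)) := by
  intro a k
  simp only [rootSet, Finset.mem_insert, Finset.mem_singleton] at hr
  rcases hr with rfl | rfl | rfl | rfl | rfl | rfl | rfl | rfl <;>
    fin_cases a <;> fin_cases k <;>
    simp [matU, zCoord, zsCoord, vecE, descend_mk, polyE, MvPolynomial.pderiv_X, eMat, eNorm,
      Fin.sum_univ_four]

/-- The structure constants of `so(5)`. -/
def structConst (r s : ℤ × ℤ) : ℤ :=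
  if r + s ∈ rootSet then
    -- The coefficient of the commutator along `eMat (r + s)` for the trace pairing. For two short
    -- roots the factor `invSqrt2 * invSqrt2 = 1 / 2` forces a further division by 2. For roots the
    -- integer division is exact, by `eMat_commutator`.
    ((eMat s * eMat r - eMat r * eMat s) * (eMat (r + s)).transpose).trace /
      ((eMat (r + s) * (eMat (r + s)).transpose).trace * if IsShort r ∧ IsShort s then 2 else 1)
  else 0

theorem structConst_eq_zero {r s : ℤ × ℤ} (h : r + s ∉ rootSet) : structConst r s = 0 := if_neg h

theorem structConst_eq_one_or : ∀ r ∈ rootSet, ∀ s ∈ rootSet, r + s ∈ rootSet →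
    structConst r s = 1 ∨ structConst r s = -1 := by
  decide +kernel

theorem eMat_commutator : ∀ r ∈ rootSet, ∀ s ∈ rootSet, r + s ≠ 0 →
    eMat s * eMat r - eMat r * eMat s =
      (structConst r s * if IsShort r ∧ IsShort s then 2 else 1) • eMat (r + s) := by
  decide +kernel

theorem eMat_commutator_neg : ∀ r ∈ rootSet,
    (if IsShort r then 1 else 2 : ℤ) • (eMat (-r) * eMat r - eMat r * eMat (-r)) =
      r.1 • hMat 0 + r.2 • hMat 1 := by
  decide +kernel

theorem hMat_eMat_commutator : ∀ j : Fin 2, ∀ r ∈ rootSet,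
    eMat r * hMat j - hMat j * eMat r = (2 * (![r.1, r.2] j)) • eMat r := by
  decide +kernel

theorem hMat_commutator : ∀ j k : Fin 2, hMat k * hMat j - hMat j * hMat k = 0 := by
  decide +kernel

theorem isShort_add : ∀ r ∈ rootSet, ∀ s ∈ rootSet, r + s ∈ rootSet →
    (IsShort r ∧ IsShort s ∧ ¬ IsShort (r + s)) ∨ (IsShort r ∧ ¬ IsShort s ∧ IsShort (r + s)) ∨
      (¬ IsShort r ∧ IsShort s ∧ IsShort (r + s)) := by
  decide +kernel

theorem neg_mem_rootSet : ∀ r ∈ rootSet, -r ∈ rootSet := by decide +kernel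

theorem lie_vecE {r s : ℤ × ℤ} (hr : r ∈ rootSet) (hs : s ∈ rootSet) (hrs : r + s ≠ 0) :
    ⁅vecE r, vecE s⁆ = (structConst r s : ℂ) • vecE (r + s) := by
  have h := (actsBy_vecE hr).lie (actsBy_vecE hs)
  have hc := congrArg castMat (eMat_commutator r hr s hs hrs)
  rw [map_sub, map_mul, map_mul, map_zsmul, ← Int.cast_smul_eq_zsmul ℂ] at hc
  rw [smul_mul_smul_comm, smul_mul_smul_comm, mul_comm (eNorm r), ← smul_sub, hc, smul_smul] at h
  by_cases hm : r + s ∈ rootSet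
  · refine h.unique ?_
    convert (actsBy_vecE hm).smul (structConst r s : ℂ) using 1
    rw [smul_smul]
    congr 1
    -- Two short roots add up to a long one and the product of their normalisations is `1 / 2`; in
    -- the mixed cases that product is already `eNorm (r + s)`.
    rcases isShort_add r hr s hs hm with ⟨h1, h2, h3⟩ | ⟨h1, h2, h3⟩ | ⟨h1, h2, h3⟩ <;>
      simp only [eNorm, h1, h2, h3, if_true, if_false, and_true, and_false] <;> push_cast
    · linear_combination (2 * (structConst r s : ℂ)) * invSqrt2_mul_self
    · ring
    · ring
  · rw [structConst_eq_zero hm, zero_mul, Int.cast_zero, mul_zero, zero_smul] at h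
    rw [structConst_eq_zero hm, Int.cast_zero, zero_smul]
    exact h.unique actsBy_zero

theorem lie_vecE_neg {r : ℤ × ℤ} (hr : r ∈ rootSet) :
    ⁅vecE r, vecE (-r)⁆ = (r.1 : ℂ) • vecH 0 + (r.2 : ℂ) • vecH 1 := by
  have h := (actsBy_vecE hr).lie (actsBy_vecE (neg_mem_rootSet r hr))
  have hc := congrArg castMat (eMat_commutator_neg r hr)
  rw [map_zsmul, map_sub, map_mul, map_mul, map_add, map_zsmul, map_zsmul,
    ← Int.cast_smul_eq_zsmul ℂ, ← Int.cast_smul_eq_zsmul ℂ, ← Int.cast_smul_eq_zsmul ℂ] at hc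
  refine h.unique ?_
  convert ((actsBy_vecH 0).smul (r.1 : ℂ)).add ((actsBy_vecH 1).smul (r.2 : ℂ)) using 1
  have hn : eNorm (-r) = eNorm r := by simp [eNorm, IsShort]
  have hsq : eNorm r * eNorm r = (1 / 2 : ℂ) * ((if IsShort r then 1 else 2 : ℤ) : ℂ) := by
    by_cases hs : IsShort r
    · simp only [eNorm, hs, if_true, invSqrt2_mul_self]; norm_num
    · simp only [eNorm, hs, if_false]; norm_num
  rw [smul_mul_smul_comm, smul_mul_smul_comm, hn, ← smul_sub, hsq, mul_smul, hc]
  module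

theorem lie_vecH_vecE (j : Fin 2) {r : ℤ × ℤ} (hr : r ∈ rootSet) :
    ⁅vecH j, vecE r⁆ = (![(r.1 : ℂ), (r.2 : ℂ)] j) • vecE r := by
  have h := (actsBy_vecH j).lie (actsBy_vecE hr)
  have hc := congrArg castMat (hMat_eMat_commutator j r hr)
  rw [map_sub, map_mul, map_mul, map_zsmul, ← Int.cast_smul_eq_zsmul ℂ] at hc
  refine h.unique ?_
  convert (actsBy_vecE hr).smul (![(r.1 : ℂ), (r.2 : ℂ)] j) using 1
  rw [smul_mul_smul_comm, smul_mul_smul_comm, mul_comm (eNorm r), ← smul_sub, hc, smul_smul,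
    smul_smul]
  congr 1
  fin_cases j <;> simp <;> ring

theorem lie_vecH (j k : Fin 2) : ⁅vecH j, vecH k⁆ = 0 := by
  have h := (actsBy_vecH j).lie (actsBy_vecH k)
  have hc := congrArg castMat (hMat_commutator j k)
  rw [map_sub, map_mul, map_mul, map_zero] at hc
  rw [smul_mul_smul_comm, smul_mul_smul_comm, ← smul_sub, hc, smul_zero] at h
  exact h.unique actsBy_zero

/-- The weight of a root. -/
def rootWt (r : ℤ × ℤ) : Wt := (r.1, r.2)

/-- The usual ladder argument: an eigenvector for the bracket with `H_j` shifts eigenvalues of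
`H_j`. Weights of the generators are thus read off from the Lie algebra relations. -/
theorem mem_opWeight_of_lie_vecH {d : Derivation ℂ S7 S7} {r : Wt}
    (h0 : ⁅vecH 0, d⁆ = (r.1 : ℂ) • d) (h1 : ⁅vecH 1, d⁆ = (r.2 : ℂ) • d) :
    d.toLinearMap ∈ opWeight wtS7 r := by
  intro s a ha
  have e0 := DFunLike.congr_fun h0 a
  have e1 := DFunLike.congr_fun h1 a
  rw [Derivation.commutator_apply, Derivation.smul_apply, sub_eq_iff_eq_add] at e0 e1
  change vecH 0 (d a) = _ ∧ vecH 1 (d a) = _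
  rw [e0, e1, ha.1, ha.2]
  simp only [Derivation.map_smul, Prod.fst_add, Prod.snd_add, Rat.cast_add, add_smul]
  exact ⟨add_comm _ _, add_comm _ _⟩

theorem vecH_mem_opWeight (j : Fin 2) : (vecH j).toLinearMap ∈ opWeight wtS7 0 :=
  mem_opWeight_of_lie_vecH (by simp [lie_vecH]) (by simp [lie_vecH])

theorem vecE_mem_opWeight {r : ℤ × ℤ} (hr : r ∈ rootSet) :
    (vecE r).toLinearMap ∈ opWeight wtS7 (rootWt r) :=
  mem_opWeight_of_lie_vecH (by simp [lie_vecH_vecE _ hr, rootWt])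
    (by simp [lie_vecH_vecE _ hr, rootWt])

/-! ### Equivariance and coinvariants -/

/-- Equivariance of a linear map for the coaction. -/
def IsEquivariant (ψ : Module.End ℂ S7) : Prop := ∀ a, coact (ψ a) = ψ.rTensor SU2 (coact a)

theorem rTensor_derivation_mul (d : Derivation ℂ S7 S7) (X Y : S7 ⊗[ℂ] SU2) :
    d.toLinearMap.rTensor SU2 (X * Y) =
      X * d.toLinearMap.rTensor SU2 Y + Y * d.toLinearMap.rTensor SU2 X := by
  induction X using TensorProduct.induction_on with
  | zero => simp
  | add X X' h h' => simp only [add_mul, map_add, mul_add, h, h']; abel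
  | tmul x h =>
  induction Y using TensorProduct.induction_on with
  | zero => simp
  | add Y Y' h h' => simp only [add_mul, map_add, mul_add, h, h']; abel
  | tmul y k =>
  simp only [Algebra.TensorProduct.tmul_mul_tmul, LinearMap.rTensor_tmul, Derivation.coeFn_coe,
    Derivation.leibniz, smul_eq_mul, TensorProduct.add_tmul]
  rw [mul_comm k h]

/-- On `u` the derivation mixes rows and the coaction mixes columns, so the two commute. This
extends to products because `d ⊗ id` is again a derivation (`rTensor_derivation_mul`). -/
theorem ActsBy.isEquivariant {d : Derivation ℂ S7 S7} {M : Matrix (Fin 4) (Fin 4) ℂ}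
    (h : ActsBy d M) : IsEquivariant d.toLinearMap := by
  intro x
  induction x using S7.induction_matU with
  | hC c =>
    have : d.toLinearMap (algebraMap ℂ S7 c) = 0 := d.map_algebraMap c
    rw [this, map_zero, AlgHom.commutes, Algebra.TensorProduct.algebraMap_apply,
      LinearMap.rTensor_tmul, this, TensorProduct.zero_tmul]
  | hU a k =>
    change coact (d (matU a k)) = _
    rw [h a k, map_sum, coact_matU, matUW, map_sum]
    simp only [map_smul, coact_matU, matUW, LinearMap.rTensor_tmul, Derivation.coeFn_coe, h a,
      TensorProduct.sum_tmul, Finset.smul_sum, TensorProduct.smul_tmul']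
    exact Finset.sum_comm
  | hadd x y hx hy => rw [map_add, map_add, map_add, map_add, hx, hy]
  | hmul x y hx hy =>
    rw [map_mul coact, rTensor_derivation_mul, ← hx, ← hy]
    simp only [Derivation.coeFn_coe, Derivation.leibniz, smul_eq_mul, map_add, map_mul]

theorem IsEquivariant.lie {ψ lam : Module.End ℂ S7} (h : IsEquivariant ψ) (h' : IsEquivariant lam) :
    IsEquivariant ⁅ψ, lam⁆ := by
  intro a
  have e : (⁅ψ, lam⁆ : Module.End ℂ S7) = ψ ∘ₗ lam - lam ∘ₗ ψ := rfl
  rw [e, LinearMap.rTensor_sub, LinearMap.rTensor_comp, LinearMap.rTensor_comp]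
  simp only [LinearMap.sub_apply, LinearMap.comp_apply, map_sub]
  rw [h, h', h', h]

/-- The subalgebra of coinvariants of `O(S⁷)`. -/
def S4 : Subalgebra ℂ S7 := AlgHom.equalizer coact Algebra.TensorProduct.includeLeft

theorem mem_S4 {b : S7} : b ∈ S4 ↔ coact b = b ⊗ₜ[ℂ] 1 := Iff.rfl

theorem rTensor_mulLeft_comp (b : S7) (ψ : Module.End ℂ S7) (X : S7 ⊗[ℂ] SU2) :
    (LinearMap.mulLeft ℂ b ∘ₗ ψ).rTensor SU2 X = (b ⊗ₜ[ℂ] 1) * ψ.rTensor SU2 X := by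
  induction X using TensorProduct.induction_on with
  | zero => simp
  | add X X' h h' => simp only [map_add, mul_add, h, h']
  | tmul x h => simp

theorem IsEquivariant.mulLeft_comp {ψ : Module.End ℂ S7} (h : IsEquivariant ψ) {b : S7}
    (hb : b ∈ S4) : IsEquivariant (LinearMap.mulLeft ℂ b ∘ₗ ψ) := by
  intro a
  rw [rTensor_mulLeft_comp, ← h, ← mem_S4.1 hb, ← map_mul]
  rfl

/-! ### Classical generation by symplectic linear algebra -/

/-- Rows of functions that the coaction multiplies by the matrix `w`. -/
def IsWRow (x : Fin 2 → S7) : Prop := ∀ k, coact (x k) = ∑ j, x j ⊗ₜ[ℂ] matW j k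

theorem isWRow_matU (a : Fin 4) : IsWRow (matU a) := fun k => coact_matU a k

theorem IsEquivariant.isWRow {ψ : Module.End ℂ S7} (h : IsEquivariant ψ) {x : Fin 2 → S7}
    (hx : IsWRow x) : IsWRow fun k => ψ (x k) := fun k => by
  rw [h, hx k, map_sum]
  simp

/-- The determinant of two rows. -/
def rowDet (x y : Fin 2 → S7) : S7 := x 0 * y 1 - x 1 * y 0

/-- Determinants are multiplicative and `w` has determinant one, which is the relation `su2_rel`. -/
theorem rowDet_mem_S4 {x y : Fin 2 → S7} (hx : IsWRow x) (hy : IsWRow y) : rowDet x y ∈ S4 := by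
  have h1 : ∀ (x : S7) (h : SU2), x ⊗ₜ[ℂ] h = (x ⊗ₜ[ℂ] (1 : SU2)) * ((1 : S7) ⊗ₜ[ℂ] h) := by
    intro x h; simp
  have hw : ((1 : S7) ⊗ₜ[ℂ] wsCoord 0) * (1 ⊗ₜ wCoord 0) + (1 ⊗ₜ wsCoord 1) * (1 ⊗ₜ wCoord 1)
      = 1 := by
    simp only [Algebra.TensorProduct.tmul_mul_tmul, mul_one, ← TensorProduct.tmul_add, su2_rel]
    rfl
  have e : (x 0 * y 1 - x 1 * y 0) ⊗ₜ[ℂ] (1 : SU2) =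
      (x 0 ⊗ₜ 1) * (y 1 ⊗ₜ 1) - (x 1 ⊗ₜ 1) * (y 0 ⊗ₜ 1) := by
    simp [TensorProduct.sub_tmul]
  rw [mem_S4, rowDet, e, map_sub, map_mul, map_mul, hx, hx, hy, hy]
  simp only [Fin.sum_univ_two, matW, Matrix.of_apply, Matrix.cons_val, TensorProduct.tmul_neg]
  rw [h1 (x 0) (wCoord 0), h1 (x 0) (wsCoord 1), h1 (x 1) (wCoord 1), h1 (x 1) (wsCoord 0),
    h1 (y 0) (wCoord 0), h1 (y 0) (wsCoord 1), h1 (y 1) (wCoord 1), h1 (y 1) (wsCoord 0)]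
  linear_combination ((x 0 ⊗ₜ[ℂ] (1 : SU2)) * (y 1 ⊗ₜ 1) - (x 1 ⊗ₜ 1) * (y 0 ⊗ₜ 1)) * hw

/-- The rows of the matrix `u` satisfy the symplectic form of the sphere relation. -/
theorem rowDet_matU : rowDet (matU 0) (matU 1) + rowDet (matU 2) (matU 3) = 1 := matU_rel

/-- The symmetric matrix of functions that describes a derivation with values `v` on the rows of
the matrix `u`. -/
def derMat (v : Fin 4 → Fin 2 → S7) (a c : Fin 4) : S7 :=
  rowDet (v a) (matU c) + rowDet (v c) (matU a)
    - (rowDet (v 1) (matU a) * rowDet (matU 0) (matU c)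
      - rowDet (v 0) (matU a) * rowDet (matU 1) (matU c)
      + rowDet (v 3) (matU a) * rowDet (matU 2) (matU c)
      - rowDet (v 2) (matU a) * rowDet (matU 3) (matU c))

theorem derMat_mem_S4 {v : Fin 4 → Fin 2 → S7} (hv : ∀ a, IsWRow (v a)) (a c : Fin 4) :
    derMat v a c ∈ S4 := by
  have h : ∀ b c, rowDet (v b) (matU c) ∈ S4 := fun b c => rowDet_mem_S4 (hv b) (isWRow_matU c)
  have h' : ∀ b c, rowDet (matU b) (matU c) ∈ S4 := fun b c =>
    rowDet_mem_S4 (isWRow_matU b) (isWRow_matU c)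
  unfold derMat
  exact sub_mem (add_mem (h _ _) (h _ _)) (sub_mem (add_mem (sub_mem (mul_mem (h _ _) (h' _ _))
    (mul_mem (h _ _) (h' _ _))) (mul_mem (h _ _) (h' _ _))) (mul_mem (h _ _) (h' _ _)))

/-- Differentiating the symplectic relation `rowDet_matU` gives the constraint that makes `derMat`
symmetric. -/
theorem rowDet_derivation (d : Derivation ℂ S7 S7) {v : Fin 4 → Fin 2 → S7}
    (hv : ∀ a k, d (matU a k) = v a k) :
    rowDet (v 0) (matU 1) - rowDet (v 1) (matU 0) + (rowDet (v 2) (matU 3) - rowDet (v 3) (matU 2))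
      = 0 := by
  have h := congrArg d rowDet_matU
  simp only [rowDet, map_add, map_sub, Derivation.leibniz, smul_eq_mul, hv,
    Derivation.map_one_eq_zero] at h ⊢
  linear_combination h

/-- Only the subtracted part of `derMat` fails to be visibly symmetric. By the Plücker relation its
antisymmetrisation is, up to sign, the minor of rows `a` and `c` of `u` times the left-hand side of
`hv`. -/
theorem derMat_symm {v : Fin 4 → Fin 2 → S7}
    (hv : rowDet (v 0) (matU 1) - rowDet (v 1) (matU 0) +
      (rowDet (v 2) (matU 3) - rowDet (v 3) (matU 2)) = 0) (a c : Fin 4) :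
    derMat v a c = derMat v c a := by
  simp only [rowDet] at hv
  simp only [derMat, rowDet]
  linear_combination (matU a 0 * matU c 1 - matU a 1 * matU c 0) * hv

/-- For rows `x`, `y`, `z` of length two, Cramer's rule reads `⟨x, y⟩ z = ⟨z, y⟩ x - ⟨z, x⟩ y` with
`⟨·, ·⟩ = rowDet`. Summed over the two symplectic pairs it expands `v a` with coefficients `⟨v a, u
c⟩`. The other two contributions to `derMat` expand to one and the same row with opposite signs, so
they restore symmetry without changing the result. -/
theorem derMat_spec {v : Fin 4 → Fin 2 → S7} (a : Fin 4) (k : Fin 2) :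
    v a k = derMat v a 1 * matU 0 k - derMat v a 0 * matU 1 k
      + derMat v a 3 * matU 2 k - derMat v a 2 * matU 3 k := by
  have h := rowDet_matU
  simp only [rowDet] at h
  simp only [derMat, rowDet]
  fin_cases k <;> simp only [Fin.zero_eta, Fin.mk_one]
  · linear_combination (-(v a 0 - ((v 1 0 * matU a 1 - v 1 1 * matU a 0) * matU 0 0
      - (v 0 0 * matU a 1 - v 0 1 * matU a 0) * matU 1 0
      + (v 3 0 * matU a 1 - v 3 1 * matU a 0) * matU 2 0
      - (v 2 0 * matU a 1 - v 2 1 * matU a 0) * matU 3 0))) * h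
  · linear_combination (-(v a 1 - ((v 1 0 * matU a 1 - v 1 1 * matU a 0) * matU 0 1
      - (v 0 0 * matU a 1 - v 0 1 * matU a 0) * matU 1 1
      + (v 3 0 * matU a 1 - v 3 1 * matU a 0) * matU 2 1
      - (v 2 0 * matU a 1 - v 2 1 * matU a 0) * matU 3 1))) * h

/-- The ten derivations `H_j`, `E_r` of `O(S⁷)`. -/
def classicalGens : Fin 2 ⊕ rootSet → Derivation ℂ S7 S7 := Sum.elim vecH fun r => vecE r

/-- The matrices by which the ten derivations act. -/
def genMat : Fin 2 ⊕ rootSet → Matrix (Fin 4) (Fin 4) ℂ :=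
  Sum.elim (fun j => (1 / 2 : ℂ) • castMat (hMat j)) fun r => eNorm r • castMat (eMat r)

theorem actsBy_classicalGens (i : Fin 2 ⊕ rootSet) : ActsBy (classicalGens i) (genMat i) := by
  rcases i with j | r
  · exact actsBy_vecH j
  · exact actsBy_vecE r.2

/-- The weights of the ten derivations. -/
def genWt : Fin 2 ⊕ rootSet → Wt := Sum.elim 0 fun r => rootWt r

theorem classicalGens_mem_opWeight (i : Fin 2 ⊕ rootSet) :
    (classicalGens i).toLinearMap ∈ opWeight wtS7 (genWt i) := by
  rcases i with j | r
  · exact vecH_mem_opWeight j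
  · exact vecE_mem_opWeight r.2

theorem sum_rootSet {M : Type*} [AddCommMonoid M] (f : ℤ × ℤ → M) :
    ∑ r : rootSet, f r = f (1, 0) + f (-1, 0) + f (0, 1) + f (0, -1) + f (1, 1) + f (-1, -1)
      + f (1, -1) + f (-1, 1) := by
  rw [Finset.sum_coe_sort rootSet f, rootSet]
  repeat rw [Finset.sum_insert (by decide)]
  rw [Finset.sum_singleton]
  simp only [add_assoc]

/-- The coefficients of a derivation with respect to the `E_r`. -/
def eCoeff (Y : Fin 4 → Fin 4 → S7) (r : ℤ × ℤ) : S7 :=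
  if r = (1, 0) then (2 * invSqrt2) • Y 2 1
  else if r = (-1, 0) then (2 * invSqrt2) • Y 0 3
  else if r = (0, 1) then -((2 * invSqrt2) • Y 0 2)
  else if r = (0, -1) then (2 * invSqrt2) • Y 3 1
  else if r = (1, 1) then Y 2 2
  else if r = (-1, -1) then -Y 3 3
  else if r = (1, -1) then -Y 1 1
  -- Among the roots only `(-1, 1)` reaches this branch.
  else Y 0 0

/-- The coefficients of a derivation with respect to the `H_j`. -/
def hCoeff (Y : Fin 4 → Fin 4 → S7) : Fin 2 → S7 := ![Y 0 1 - Y 2 3, -Y 0 1 - Y 2 3]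

theorem sum_derivation_apply {ι : Type*} (s : Finset ι) (D : ι → Derivation ℂ S7 S7) (x : S7) :
    (∑ i ∈ s, D i) x = ∑ i ∈ s, D i x := by
  classical
  induction s using Finset.induction_on with
  | empty => simp
  | insert i s hi h => rw [Finset.sum_insert hi, Finset.sum_insert hi, Derivation.add_apply, h]

/-- Equivariant derivations of `O(S⁷)` are combinations of the `H_j` and `E_r` with coinvariant
coefficients. -/
theorem exists_coeff_of_isEquivariant {d : Derivation ℂ S7 S7} (hd : IsEquivariant d.toLinearMap) :
    ∃ b : Fin 2 ⊕ rootSet → S7, (∀ i, b i ∈ S4) ∧ d = ∑ i, b i • classicalGens i := by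
  set v : Fin 4 → Fin 2 → S7 := fun a k => d (matU a k) with hv
  have hrow : ∀ a, IsWRow (v a) := fun a => hd.isWRow (isWRow_matU a)
  have hS := derMat_mem_S4 hrow
  have hsymm := derMat_symm (rowDet_derivation d (v := v) fun a k => rfl)
  have hspec := derMat_spec (v := v)
  -- From here only three facts matter: the entries are coinvariant, the matrix is symmetric, and it
  -- expands `v`.
  generalize derMat v = Y at hS hsymm hspec
  refine ⟨Sum.elim (hCoeff Y) fun r => eCoeff Y r, ?_, ?_⟩
  · rintro (j | r)
    · fin_cases j
      · exact sub_mem (hS _ _) (hS _ _)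
      · exact sub_mem (neg_mem (hS _ _)) (hS _ _)
    · simp only [Sum.elim_inr, eCoeff]
      split_ifs <;>
        first
        | exact hS _ _
        | exact neg_mem (hS _ _)
        | exact S4.smul_mem (hS _ _) _
        | exact neg_mem (S4.smul_mem (hS _ _) _)
  · refine derivation_ext_matU fun a k => ?_
    -- The factor `2 * invSqrt2` in the short-root coefficients inverts the normalisation of `E_r`.
    have h2 : invSqrt2 * (2 * invSqrt2) = 1 := by linear_combination 2 * invSqrt2_mul_self
    have key : (∑ i, Sum.elim (hCoeff Y) (fun r : rootSet => eCoeff Y r) i • classicalGens i)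
        (matU a k) = ∑ j, hCoeff Y j * (∑ b, ((1 / 2 : ℂ) • castMat (hMat j)) a b • matU b k) +
          ∑ r : rootSet, eCoeff Y r * (∑ b, (eNorm r • castMat (eMat r)) a b • matU b k) := by
      rw [sum_derivation_apply, Fintype.sum_sum_type]
      exact congrArg₂ (· + ·)
        (Finset.sum_congr rfl fun j _ => congrArg (hCoeff Y j * ·) (actsBy_vecH j a k))
        (Finset.sum_congr rfl fun r _ => congrArg (eCoeff Y r * ·) (actsBy_vecE r.2 a k))
    rw [key, sum_rootSet fun r => eCoeff Y r * (∑ b, (eNorm r • castMat (eMat r)) a b • matU b k),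
      show d (matU a k) = v a k from rfl, hspec]
    fin_cases a
    · simp [eMat, hMat, eNorm, eCoeff, hCoeff, Fin.sum_univ_four, IsShort, smul_smul, h2, sub_mul,
        smul_sub]
      module
    · simp [eMat, hMat, eNorm, eCoeff, hCoeff, Fin.sum_univ_four, IsShort, smul_smul, h2, sub_mul,
        smul_sub]
      -- A short-root matrix has two nonzero entries and the `H_j` are diagonal, while each
      -- coefficient uses a single entry of `Y`; symmetry supplies the agreement with the other
      -- rows.
      rw [hsymm 1 0, hsymm 1 2, hsymm 1 3]
      module
    · simp [eMat, hMat, eNorm, eCoeff, hCoeff, Fin.sum_univ_four, IsShort, smul_smul, h2, sub_mul,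
        smul_sub]
      rw [hsymm 2 0]
      module
    · simp [eMat, hMat, eNorm, eCoeff, hCoeff, Fin.sum_univ_four, IsShort, smul_smul, h2, sub_mul,
        smul_sub]
      rw [hsymm 3 0, hsymm 3 2]
      module

/-! ### Linear independence by evaluation at coordinate points -/

/-- The character of `O(S⁷)` given by the point with `z_a = z_a^* = 1` and other coordinates `0`. -/
def basePoint (a : Fin 4) : S7 →ₐ[ℂ] ℂ :=
  Ideal.Quotient.liftₐ (Ideal.span {sphereRel})
    (MvPolynomial.aeval (Sum.elim (Pi.single a 1) (Pi.single a 1))) (by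
      intro p hp
      obtain ⟨c, rfl⟩ := Ideal.mem_span_singleton'.1 hp
      rw [map_mul]
      convert mul_zero _
      fin_cases a <;> simp [sphereRel, Fin.sum_univ_four])

theorem basePoint_matU (a b : Fin 4) : basePoint a (matU b 0) = (1 : Matrix _ _ ℂ) a b := by
  have h : ∀ b, basePoint a (zCoord b) = (Pi.single a 1 : Fin 4 → ℂ) b := fun b =>
    MvPolynomial.aeval_X _ (Sum.inl b)
  have e : matU b 0 = zCoord b := by fin_cases b <;> rfl
  rw [e, h, Pi.single_apply, Matrix.one_apply, eq_comm]
  simp only [eq_comm]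

theorem exists_eMat_entry : ∀ r ∈ rootSet, ∃ p : Fin 4 × Fin 4, eMat r p.1 p.2 ≠ 0 ∧
    (∀ s ∈ rootSet, s = r ∨ eMat s p.1 p.2 = 0) ∧ ∀ j, hMat j p.1 p.2 = 0 := by
  decide +kernel

theorem eMat_diag : ∀ r ∈ rootSet, ∀ a, eMat r a a = 0 := by decide +kernel

theorem eNorm_ne_zero (r : ℤ × ℤ) : eNorm r ≠ 0 := by
  unfold eNorm
  split_ifs
  exacts [invSqrt2_ne_zero, one_ne_zero]

/-- A relation among the derivations gives one among the constant matrices. The diagonal separates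
the `H_j`, and each root matrix has a nonzero entry at which the other nine vanish
(`exists_eMat_entry`). -/
theorem linearIndependent_classicalGens : LinearIndependent ℂ classicalGens := by
  rw [Fintype.linearIndependent_iff]
  intro c hc
  have key : ∀ a b, ∑ i, c i * genMat i a b = 0 := by
    intro a b
    -- At this point the first column of `u` becomes the `b`-th unit vector, so applying the
    -- relation to `matU a 0` extracts the `(a, b)` matrix entry.
    have h := congrArg (basePoint b) (DFunLike.congr_fun hc (matU a 0))
    rw [sum_derivation_apply, map_sum] at h
    simp only [Derivation.smul_apply, actsBy_classicalGens _ a 0, map_smul, map_sum,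
      basePoint_matU, Matrix.one_apply, smul_eq_mul, mul_ite, mul_one, mul_zero,
      Finset.sum_ite_eq, Finset.mem_univ, if_true, Derivation.zero_apply, map_zero] at h
    exact h
  have hdiag : ∀ a, c (Sum.inl 0) * (hMat 0 a a : ℂ) + c (Sum.inl 1) * (hMat 1 a a : ℂ) = 0 := by
    intro a
    have h := key a a
    rw [Fintype.sum_sum_type, Fin.sum_univ_two,
      Finset.sum_eq_zero (s := (Finset.univ : Finset rootSet))
        (fun r _ => by simp [genMat, eMat_diag r.1 r.2 a])] at h
    simp only [genMat, Sum.elim_inl, Matrix.smul_apply, RingHom.mapMatrix_apply, Matrix.map_apply,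
      smul_eq_mul, Int.coe_castRingHom, add_zero] at h
    linear_combination 2 * h
  rintro (j | r)
  · have h0 := hdiag 0
    have h2 := hdiag 2
    simp [hMat] at h0 h2
    fin_cases j <;> simp only [Fin.zero_eta, Fin.mk_one]
    · linear_combination (1 / 2 : ℂ) * h0 - (1 / 2 : ℂ) * h2
    · linear_combination -(1 / 2 : ℂ) * h0 - (1 / 2 : ℂ) * h2
  · obtain ⟨⟨a, b⟩, h1, h2, h3⟩ := exists_eMat_entry r r.2
    have h := key a b
    rw [Finset.sum_eq_single_of_mem (Sum.inr r) (Finset.mem_univ _)] at h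
    · refine (mul_eq_zero.1 h).resolve_right ?_
      simpa [genMat, eNorm_ne_zero] using h1
    · rintro (j | s) - hne
      · simp [genMat, h3]
      · have := (h2 s s.2).resolve_left fun h => hne (congrArg Sum.inr (Subtype.ext h))
        simp [genMat, this]

/-! ### Twisting the equivariant derivations -/

/-- The coaction does not change the weight of the left tensor factor (`coact_mem`). Hence diagonal
operators, and by `decompose_eq_diagOp` the projections to weight spaces, preserve coinvariants. -/
theorem coact_diagOp (χ : Wt → ℂ) (a : S7) :
    coact (diagOp wtS7 χ a) = (diagOp wtS7 χ).rTensor SU2 (coact a) := by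
  induction a using DirectSum.Decomposition.inductionOn wtS7 with
  | zero => simp
  | add a a' h h' => simp only [map_add, h, h']
  | @homogeneous s a =>
  rw [diagOp_apply wtS7 χ a.2, map_smul]
  have h : ∀ X ∈ wtTensor s, χ s • X = (diagOp wtS7 χ).rTensor SU2 X := by
    intro X hX
    induction hX using Submodule.span_induction with
    | zero => simp
    | add X X' _ _ h h' => rw [smul_add, map_add, h, h']
    | smul c X _ h => rw [smul_comm, map_smul, h]
    | mem X hX =>
    obtain ⟨x, hx, k, rfl⟩ := hX
    rw [LinearMap.rTensor_tmul, diagOp_apply wtS7 χ hx, TensorProduct.smul_tmul']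
  exact h _ (coact_mem a.2)

theorem diagOp_mem_S4 (χ : Wt → ℂ) {b : S7} (hb : b ∈ S4) : diagOp wtS7 χ b ∈ S4 := by
  rw [mem_S4, coact_diagOp, mem_S4.1 hb, LinearMap.rTensor_tmul]

theorem decompose_eq_diagOp (b : S7) (s : Wt) :
    (DirectSum.decompose wtS7 b s : S7) = diagOp wtS7 (Pi.single s 1) b := by
  induction b using DirectSum.Decomposition.inductionOn wtS7 with
  | zero => simp
  | add a a' h h' => rw [DirectSum.decompose_add, DirectSum.add_apply, Submodule.coe_add, h, h',
      map_add]
  | @homogeneous t b =>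
  rw [diagOp_apply wtS7 _ b.2]
  by_cases hts : t = s
  · subst hts
    rw [DirectSum.decompose_of_mem_same _ b.2, Pi.single_eq_same, one_smul]
  · rw [DirectSum.decompose_of_mem_ne _ b.2 hts, Pi.single_eq_of_ne hts, zero_smul]

theorem toTwistTensor_injective (θ : ℝ) : Function.Injective (toTwistTensor θ) := by
  refine Function.LeftInverse.injective (g := (toTwist wtS7 θ).symm.toLinearMap.rTensor SU2) ?_
  intro X
  rw [toTwistTensor, ← LinearMap.comp_apply, ← LinearMap.rTensor_comp]
  have : (toTwist wtS7 θ).symm.toLinearMap ∘ₗ (toTwist wtS7 θ).toLinearMap = LinearMap.id := by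
    ext x; simp
  rw [this, LinearMap.rTensor_id, LinearMap.id_apply]

theorem coactT_toTwist (θ : ℝ) (a : S7) :
    coactT θ (toTwist wtS7 θ a) = toTwistTensor θ (coact a) := rfl

theorem toTwist_mem_S4t (θ : ℝ) {b : S7} : toTwist wtS7 θ b ∈ S4t θ ↔ b ∈ S4 := by
  rw [mem_S4t, mem_S4, coactT_toTwist]
  exact (toTwistTensor_injective θ).eq_iff' rfl

theorem twistD_rTensor (θ : ℝ) (ψ : Module.End ℂ S7) {s : Wt} {X : S7 ⊗[ℂ] SU2}
    (hX : X ∈ wtTensor s) :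
    (twistD wtS7 θ ψ).rTensor SU2 (toTwistTensor θ X) = toTwistTensor θ
      ((diagOp wtS7 fun t => twistInv θ t s).rTensor SU2 (ψ.rTensor SU2 X)) := by
  induction hX using Submodule.span_induction with
  | zero => simp
  | add X X' _ _ h h' => simp only [map_add, h, h']
  | smul c X _ h => simp only [map_smul, h]
  | mem X hX =>
  obtain ⟨x, hx, k, rfl⟩ := hX
  simp only [toTwistTensor, LinearMap.rTensor_tmul, LinearEquiv.coe_coe,
    twistD_apply wtS7 θ ψ hx]

/-- On inputs of weight `s`, both sides of the twisted identity are the classical ones followed by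
the same injective map, the diagonal operator on the left factor. -/
theorem coactT_twistD_iff (θ : ℝ) (ψ : Module.End ℂ S7) :
    (∀ a, coactT θ (twistD wtS7 θ ψ a) = (twistD wtS7 θ ψ).rTensor SU2 (coactT θ a)) ↔
      IsEquivariant ψ := by
  have key : ∀ s, ∀ a ∈ wtS7 s,
      (coactT θ (twistD wtS7 θ ψ (toTwist wtS7 θ a)) =
        (twistD wtS7 θ ψ).rTensor SU2 (coactT θ (toTwist wtS7 θ a)) ↔
      coact (ψ a) = ψ.rTensor SU2 (coact a)) := by
    intro s a ha
    rw [twistD_apply wtS7 θ ψ ha, coactT_toTwist, coactT_toTwist,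
      twistD_rTensor θ ψ (coact_mem ha), coact_diagOp, (toTwistTensor_injective θ).eq_iff]
    refine Function.Injective.eq_iff (Function.LeftInverse.injective
      (g := (diagOp wtS7 fun t => (twistInv θ t s)⁻¹).rTensor SU2) fun X => ?_)
    rw [← LinearMap.comp_apply, ← LinearMap.rTensor_comp]
    have : (diagOp wtS7 fun t => (twistInv θ t s)⁻¹) ∘ₗ (diagOp wtS7 fun t => twistInv θ t s) =
        LinearMap.id :=
      LinearMap.ext fun x => diagOp_inv_cancel' wtS7 (fun t => twistInv_ne_zero θ t s) x
    rw [this, LinearMap.rTensor_id, LinearMap.id_apply]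
  constructor
  · intro h
    have : coact.toLinearMap ∘ₗ ψ = ψ.rTensor SU2 ∘ₗ coact.toLinearMap :=
      linearMap_ext_of_weights wtS7 fun s a ha => (key s a ha).1 (h _)
    exact LinearMap.congr_fun this
  · intro h
    have : (coactT θ).toLinearMap ∘ₗ twistD wtS7 θ ψ =
        (twistD wtS7 θ ψ).rTensor SU2 ∘ₗ (coactT θ).toLinearMap :=
      twist_hom_ext wtS7 θ fun s a ha => (key s a ha).2 (h a)
    exact LinearMap.congr_fun this

/-- The equivariant braided derivations are the twists of the equivariant derivations. -/
theorem mem_DerH_iff (θ : ℝ) {ψ : Module.End ℂ (S7t θ)} :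
    ψ ∈ DerH θ ↔ ∃ d : Derivation ℂ S7 S7, IsEquivariant d.toLinearMap ∧
      twistD wtS7 θ d.toLinearMap = ψ := by
  constructor
  · rintro ⟨h, h'⟩
    obtain ⟨d, rfl⟩ := exists_derivation_of_mem_braidedDer wtS7 θ h
    exact ⟨d, (coactT_twistD_iff θ _).1 h', rfl⟩
  · rintro ⟨d, h, rfl⟩
    exact ⟨twistD_mem_braidedDer wtS7 θ d, (coactT_twistD_iff θ _).2 h⟩

theorem gens_eq (θ : ℝ) (i : Fin 2 ⊕ rootSet) :
    gens θ i = twistD wtS7 θ (classicalGens i).toLinearMap := by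
  rcases i with j | r <;> rfl

theorem classicalGens_isEquivariant (i : Fin 2 ⊕ rootSet) :
    IsEquivariant (classicalGens i).toLinearMap := (actsBy_classicalGens i).isEquivariant

theorem twistD_smul_mem_DerH (θ : ℝ) (i : Fin 2 ⊕ rootSet) {b : S7} (hb : b ∈ S4) :
    twistD wtS7 θ (b • classicalGens i).toLinearMap ∈ DerH θ :=
  (mem_DerH_iff θ).2 ⟨_, (classicalGens_isEquivariant i).mulLeft_comp hb, rfl⟩

theorem exists_sum_of_mem_DerH (θ : ℝ) {ψ : Module.End ℂ (S7t θ)} (hψ : ψ ∈ DerH θ) :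
    ∃ b : Fin 2 ⊕ rootSet → S7, (∀ i, b i ∈ S4) ∧
      ψ = ∑ i, twistD wtS7 θ (b i • classicalGens i).toLinearMap := by
  obtain ⟨d, hd, rfl⟩ := (mem_DerH_iff θ).1 hψ
  obtain ⟨b, hb, rfl⟩ := exists_coeff_of_isEquivariant hd
  refine ⟨b, hb, ?_⟩
  have : (∑ i, b i • classicalGens i).toLinearMap = ∑ i, (b i • classicalGens i).toLinearMap := by
    ext x
    rw [LinearMap.sum_apply]
    exact sum_derivation_apply _ _ x
  rw [this]
  exact map_sum (twistDLin wtS7 θ) _ _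

/-- The dictionary between the two module structures: twisted and classical coefficients of a
generator of weight `genWt i` differ by a diagonal operator that preserves coinvariants. -/
theorem smul_gens (θ : ℝ) (i : Fin 2 ⊕ rootSet) {b : S7} (hb : b ∈ S4) :
    (⟨toTwist wtS7 θ (diagOp wtS7 (twistInv θ (genWt i)) b),
        (toTwist_mem_S4t θ).2 (diagOp_mem_S4 _ hb)⟩ : S4t θ) • gens θ i =
      twistD wtS7 θ (b • classicalGens i).toLinearMap := by
  rw [gens_eq]
  ext x
  exact (twistD_mul_left wtS7 θ (classicalGens_mem_opWeight i) b x).symm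

theorem span_gens_eq_DerH (θ : ℝ) :
    (Submodule.span (S4t θ) (Set.range (gens θ)) : Set (Module.End ℂ (S7t θ))) =
      (DerH θ : Set (Module.End ℂ (S7t θ))) := by
  ext ψ
  simp only [SetLike.mem_coe]
  constructor
  · intro h
    obtain ⟨c, rfl⟩ := (Submodule.mem_span_range_iff_exists_fun (S4t θ)).1 h
    refine sum_mem fun i _ => ?_
    obtain ⟨c, hc⟩ := c i
    obtain ⟨y, rfl⟩ := (toTwist wtS7 θ).surjective c
    -- The inverse diagonal operator yields the classical coefficient whose twist is the given one.
    have hy := diagOp_mem_S4 (fun t => (twistInv θ (genWt i) t)⁻¹) ((toTwist_mem_S4t θ).1 hc)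
    have h := smul_gens θ i hy
    simp only [diagOp_inv_cancel wtS7 (twistInv_ne_zero θ (genWt i))] at h
    rw [h]
    exact twistD_smul_mem_DerH θ i hy
  · intro h
    obtain ⟨b, hb, rfl⟩ := exists_sum_of_mem_DerH θ h
    refine sum_mem fun i _ => ?_
    rw [← smul_gens θ i (hb i)]
    exact Submodule.smul_mem _ _ (Submodule.subset_span ⟨i, rfl⟩)

/-- The weight components of a coinvariant are coinvariant, so decomposing the coefficient `b`
decomposes the operator within `DerH θ`. -/
theorem twistD_smul_mem_iSup (θ : ℝ) (i : Fin 2 ⊕ rootSet) {b : S7} (hb : b ∈ S4) :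
    twistD wtS7 θ (b • classicalGens i).toLinearMap ∈ ⨆ r, DerH θ ⊓ opWeight (wtS7t θ) r := by
  classical
  have e : (b • classicalGens i).toLinearMap = ∑ s ∈ (DirectSum.decompose wtS7 b).support,
      ((DirectSum.decompose wtS7 b s : S7) • classicalGens i).toLinearMap := by
    ext x
    rw [LinearMap.sum_apply]
    change b * classicalGens i x =
      ∑ s ∈ _, (DirectSum.decompose wtS7 b s : S7) * classicalGens i x
    rw [← Finset.sum_mul, DirectSum.sum_support_decompose]
  rw [e, ← twistDLin_apply, map_sum]
  refine sum_mem fun s _ => Submodule.mem_iSup_of_mem (s + genWt i) ⟨?_, ?_⟩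
  · exact twistD_smul_mem_DerH θ i (decompose_eq_diagOp b s ▸ diagOp_mem_S4 _ hb)
  · refine twistD_mem_opWeight wtS7 θ fun t a ha => ?_
    have h := SetLike.mul_mem_graded (DirectSum.decompose wtS7 b s).2
      (classicalGens_mem_opWeight i t a ha)
    rwa [show s + (t + genWt i) = t + (s + genWt i) by abel] at h

theorem isBraidedLieAlgebra_DerH (θ : ℝ) : IsBraidedLieAlgebra (wtS7t θ) θ (DerH θ) := by
  refine IsBraidedLieAlgebra.of_graded _ θ (fun ψ hψ => ?_) ?_
  · obtain ⟨b, hb, rfl⟩ := exists_sum_of_mem_DerH θ hψ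
    exact sum_mem fun i _ => twistD_smul_mem_iSup θ i (hb i)
  · rintro r s u ⟨hu, hur⟩ v ⟨hv, hvs⟩
    obtain ⟨d, hd, rfl⟩ := (mem_DerH_iff θ).1 hu
    obtain ⟨d', hd', rfl⟩ := (mem_DerH_iff θ).1 hv
    rw [braidedBracket_twistD wtS7 θ (mem_opWeight_of_twistD wtS7 θ hur)
      (mem_opWeight_of_twistD wtS7 θ hvs), ← Derivation.commutator_coe_linear_map]
    refine Submodule.smul_mem _ _ ((mem_DerH_iff θ).2 ⟨_, ?_, rfl⟩)
    rw [Derivation.commutator_coe_linear_map]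
    exact hd.lie hd'

theorem linearIndependent_gens (θ : ℝ) : LinearIndependent ℂ (gens θ) := by
  have h1 : LinearIndependent ℂ fun i => (classicalGens i).toLinearMap := by
    rw [Fintype.linearIndependent_iff]
    intro c hc
    refine Fintype.linearIndependent_iff.1 linearIndependent_classicalGens c ?_
    ext x
    rw [sum_derivation_apply]
    have := LinearMap.congr_fun hc x
    rwa [LinearMap.sum_apply] at this
  have e : gens θ = twistDLin wtS7 θ ∘ fun i => (classicalGens i).toLinearMap :=
    funext (gens_eq θ)
  rw [e]
  exact h1.map' (twistDLin wtS7 θ) (LinearMap.ker_eq_bot.2 (twistDLin_injective wtS7 θ))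

/-! ### The brackets of the twisted so(5) -/

theorem lie_classicalGens_mem_span (p q : Fin 2 ⊕ rootSet) :
    ⁅classicalGens p, classicalGens q⁆ ∈ Submodule.span ℂ (Set.range classicalGens) := by
  have hH : ∀ j, vecH j ∈ Submodule.span ℂ (Set.range classicalGens) := fun j =>
    Submodule.subset_span ⟨Sum.inl j, rfl⟩
  have hE : ∀ r ∈ rootSet, vecE r ∈ Submodule.span ℂ (Set.range classicalGens) := fun r hr =>
    Submodule.subset_span ⟨Sum.inr ⟨r, hr⟩, rfl⟩
  rcases p with j | ⟨r, hr⟩ <;> rcases q with k | ⟨s, hs⟩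
  · change ⁅vecH j, vecH k⁆ ∈ _; rw [lie_vecH]; exact zero_mem _
  · change ⁅vecH j, vecE s⁆ ∈ _
    rw [lie_vecH_vecE _ hs]; exact Submodule.smul_mem _ _ (hE s hs)
  · change ⁅vecE r, vecH k⁆ ∈ _
    rw [← lie_skew, lie_vecH_vecE _ hr]; exact neg_mem (Submodule.smul_mem _ _ (hE r hr))
  · change ⁅vecE r, vecE s⁆ ∈ _
    by_cases h : r + s = 0
    · obtain rfl : s = -r := eq_neg_of_add_eq_zero_right h
      rw [lie_vecE_neg hr]
      exact add_mem (Submodule.smul_mem _ _ (hH 0)) (Submodule.smul_mem _ _ (hH 1))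
    · rw [lie_vecE hr hs h]
      by_cases hm : r + s ∈ rootSet
      · exact Submodule.smul_mem _ _ (hE _ hm)
      · rw [structConst_eq_zero hm, Int.cast_zero, zero_smul]; exact zero_mem _

theorem braidedBracket_gens (θ : ℝ) (i j : Fin 2 ⊕ rootSet) :
    braidedBracket (wtS7t θ) θ (gens θ i) (gens θ j) = twistInv θ (genWt i) (genWt j) •
      twistD wtS7 θ (⁅classicalGens i, classicalGens j⁆ : Derivation ℂ S7 S7).toLinearMap := by
  rw [gens_eq, gens_eq, braidedBracket_twistD wtS7 θ (classicalGens_mem_opWeight i)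
    (classicalGens_mem_opWeight j), ← Derivation.commutator_coe_linear_map]

theorem twistD_smul_derivation (θ : ℝ) (c : ℂ) (d : Derivation ℂ S7 S7) :
    twistD wtS7 θ (c • d).toLinearMap = c • twistD wtS7 θ d.toLinearMap :=
  map_smul (twistDLin wtS7 θ) c d.toLinearMap

theorem twistD_add_derivation (θ : ℝ) (d d' : Derivation ℂ S7 S7) :
    twistD wtS7 θ (d + d').toLinearMap =
      twistD wtS7 θ d.toLinearMap + twistD wtS7 θ d'.toLinearMap :=
  map_add (twistDLin wtS7 θ) d.toLinearMap d'.toLinearMap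

theorem twistD_mem_span_gens (θ : ℝ) {d : Derivation ℂ S7 S7}
    (hd : d ∈ Submodule.span ℂ (Set.range classicalGens)) :
    twistD wtS7 θ d.toLinearMap ∈ Submodule.span ℂ (Set.range (gens θ)) := by
  induction hd using Submodule.span_induction with
  | zero =>
    have e : twistD wtS7 θ (0 : Derivation ℂ S7 S7).toLinearMap = 0 := map_zero (twistDLin wtS7 θ)
    rw [e]
    exact zero_mem _
  | add d d' _ _ h h' =>
    rw [twistD_add_derivation]
    exact add_mem h h'
  | smul c d _ h =>
    rw [twistD_smul_derivation]
    exact Submodule.smul_mem _ c h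
  | mem d hd =>
    obtain ⟨i, rfl⟩ := hd
    exact Submodule.subset_span ⟨i, gens_eq θ i⟩

theorem isBraidedLieAlgebra_span_gens (θ : ℝ) :
    IsBraidedLieAlgebra (wtS7t θ) θ (Submodule.span ℂ (Set.range (gens θ))) := by
  refine IsBraidedLieAlgebra.of_graded _ θ (Submodule.span_le.2 ?_) ?_
  · rintro _ ⟨i, rfl⟩
    refine Submodule.mem_iSup_of_mem (genWt i) ⟨Submodule.subset_span ⟨i, rfl⟩, ?_⟩
    rw [gens_eq]
    exact twistD_mem_opWeight wtS7 θ (classicalGens_mem_opWeight i)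
  · rintro r s u ⟨hu, -⟩ v ⟨hv, -⟩
    rw [← braidedBracketBilin_apply]
    induction hu using Submodule.span_induction with
    | zero => rw [map_zero]; exact zero_mem _
    | add u u' _ _ h h' => rw [map_add]; exact add_mem h h'
    | smul c u _ h => rw [map_smul]; exact Submodule.smul_mem _ _ h
    | mem u hu =>
    induction hv using Submodule.span_induction with
    | zero => rw [map_zero]; exact zero_mem _
    | add v v' _ _ h h' => rw [map_add]; exact add_mem h h'
    | smul c v _ h => rw [map_smul]; exact Submodule.smul_mem _ _ h
    | mem v hv =>
    obtain ⟨i, rfl⟩ := hu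
    obtain ⟨j, rfl⟩ := hv
    rw [braidedBracketBilin_apply, braidedBracket_gens]
    exact Submodule.smul_mem _ _ (twistD_mem_span_gens θ (lie_classicalGens_mem_span i j))

theorem twistInv_rootWt (θ : ℝ) (r s : ℤ × ℤ) : twistInv θ (rootWt r) (rootWt s) =
    Complex.exp (-(Complex.I * Real.pi * θ * (wedge r s : ℤ))) := by
  simp [twistInv, wedge, rootWt]

theorem twistInv_rootWt_neg (θ : ℝ) (r : ℤ × ℤ) :
    twistInv θ (rootWt r) (rootWt (-r)) = 1 := by
  simp [twistInv_rootWt, wedge, mul_comm]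

theorem braidedBracket_tildeH (θ : ℝ) (j k : Fin 2) :
    braidedBracket (wtS7t θ) θ (tildeH θ j) (tildeH θ k) =
      twistD wtS7 θ (⁅vecH j, vecH k⁆ : Derivation ℂ S7 S7).toLinearMap := by
  have h := braidedBracket_gens θ (Sum.inl j) (Sum.inl k)
  rwa [show genWt (Sum.inl j) = 0 from rfl, twistInv_zero_left, one_smul] at h

theorem braidedBracket_tildeH_tildeE (θ : ℝ) (j : Fin 2) {r : ℤ × ℤ} (hr : r ∈ rootSet) :
    braidedBracket (wtS7t θ) θ (tildeH θ j) (tildeE θ r) =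
      twistD wtS7 θ (⁅vecH j, vecE r⁆ : Derivation ℂ S7 S7).toLinearMap := by
  have h := braidedBracket_gens θ (Sum.inl j) (Sum.inr ⟨r, hr⟩)
  rwa [show genWt (Sum.inl j) = 0 from rfl, twistInv_zero_left, one_smul] at h

theorem braidedBracket_tildeE (θ : ℝ) {r s : ℤ × ℤ} (hr : r ∈ rootSet) (hs : s ∈ rootSet) :
    braidedBracket (wtS7t θ) θ (tildeE θ r) (tildeE θ s) = twistInv θ (rootWt r) (rootWt s) •
      twistD wtS7 θ (⁅vecE r, vecE s⁆ : Derivation ℂ S7 S7).toLinearMap :=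
  braidedBracket_gens θ (Sum.inr ⟨r, hr⟩) (Sum.inr ⟨s, hs⟩)

end

theorem mainTheorem4 (θ : ℝ) :
    -- the equivariant braided derivations form a braided Lie algebra
    IsBraidedLieAlgebra (wtS7t θ) θ (DerH θ) ∧
    -- generated by the `H̃_j` and `Ẽ_r` as a left module over `O(S⁴_θ)`
    ((Submodule.span (S4t θ) (Set.range (gens θ)) : Set (Module.End ℂ (S7t θ))) =
      (DerH θ : Set (Module.End ℂ (S7t θ)))) ∧
    -- the ten generators span a ten-dimensional braided Lie algebra
    LinearIndependent ℂ (gens θ) ∧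
    IsBraidedLieAlgebra (wtS7t θ) θ (Submodule.span ℂ (Set.range (gens θ))) ∧
    -- with the brackets of `so_θ(5)`
    (∀ j k : Fin 2,
      braidedBracket (wtS7t θ) θ (tildeH θ j) (tildeH θ k) =
        twistD wtS7 θ (⁅vecH j, vecH k⁆ : Derivation ℂ S7 S7).toLinearMap ∧
      braidedBracket (wtS7t θ) θ (tildeH θ j) (tildeH θ k) = 0) ∧
    (∀ j : Fin 2, ∀ r ∈ rootSet,
      braidedBracket (wtS7t θ) θ (tildeH θ j) (tildeE θ r) =
        twistD wtS7 θ (⁅vecH j, vecE r⁆ : Derivation ℂ S7 S7).toLinearMap ∧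
      braidedBracket (wtS7t θ) θ (tildeH θ j) (tildeE θ r) =
        (![(r.1 : ℂ), (r.2 : ℂ)] j) • tildeE θ r) ∧
    (∀ r ∈ rootSet,
      braidedBracket (wtS7t θ) θ (tildeE θ r) (tildeE θ (-r)) =
        twistD wtS7 θ (⁅vecE r, vecE (-r)⁆ : Derivation ℂ S7 S7).toLinearMap ∧
      braidedBracket (wtS7t θ) θ (tildeE θ r) (tildeE θ (-r)) =
        (r.1 : ℂ) • tildeH θ 0 + (r.2 : ℂ) • tildeH θ 1) ∧
    -- `N` are the structure constants of the classical `so(5)`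
    (∃ N : ℤ × ℤ → ℤ × ℤ → ℤ,
      (∀ r ∈ rootSet, ∀ s ∈ rootSet, r + s ∉ rootSet → N r s = 0) ∧
      (∀ r ∈ rootSet, ∀ s ∈ rootSet, r + s ∈ rootSet → N r s = 1 ∨ N r s = -1) ∧
      (∀ r ∈ rootSet, ∀ s ∈ rootSet, r + s ≠ 0 →
        ⁅vecE r, vecE s⁆ = (N r s : ℂ) • vecE (r + s) ∧
        braidedBracket (wtS7t θ) θ (tildeE θ r) (tildeE θ s) =
          Complex.exp (-(Complex.I * Real.pi * θ * (wedge r s : ℤ))) •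
            twistD wtS7 θ (⁅vecE r, vecE s⁆ : Derivation ℂ S7 S7).toLinearMap ∧
        braidedBracket (wtS7t θ) θ (tildeE θ r) (tildeE θ s) =
          (Complex.exp (-(Complex.I * Real.pi * θ * (wedge r s : ℤ))) * (N r s : ℂ)) •
            tildeE θ (r + s))) := by
  refine ⟨isBraidedLieAlgebra_DerH θ, span_gens_eq_DerH θ, linearIndependent_gens θ,
    isBraidedLieAlgebra_span_gens θ, fun j k => ⟨braidedBracket_tildeH θ j k, ?_⟩,
    fun j r hr => ⟨braidedBracket_tildeH_tildeE θ j hr, ?_⟩, fun r hr => ?_,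
    structConst, fun r _ s _ => structConst_eq_zero, structConst_eq_one_or,
    fun r hr s hs hrs => ⟨lie_vecE hr hs hrs, ?_, ?_⟩⟩
  · rw [braidedBracket_tildeH, lie_vecH]
    exact map_zero (twistDLin wtS7 θ)
  · rw [braidedBracket_tildeH_tildeE θ j hr, lie_vecH_vecE j hr, twistD_smul_derivation]
    rfl
  · have h := braidedBracket_tildeE θ hr (neg_mem_rootSet r hr)
    -- Opposite roots have vanishing wedge, so no phase appears.
    rw [twistInv_rootWt_neg, one_smul] at h
    refine ⟨h, ?_⟩
    rw [h, lie_vecE_neg hr, twistD_add_derivation, twistD_smul_derivation, twistD_smul_derivation]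
    rfl
  · rw [braidedBracket_tildeE θ hr hs, twistInv_rootWt]
  · rw [braidedBracket_tildeE θ hr hs, twistInv_rootWt, lie_vecE hr hs hrs,
      twistD_smul_derivation, smul_smul]
    rfl
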